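/- **Setting.** Let $M$ be a closed smooth manifold of dimension $d$ with a Riemannian metric, let $\mathrm{vol}_M$ be its Riemannian volume measure and $\mathrm{Diff}^\infty_{\mathrm{vol}}(M)$ the group of smooth volume preserving diffeomorphisms of $M$. Fix $k\in\{1,\dots,d-1\}$ and put $d'=d^2+d-1$. Write $B_r$ for the open ball of radius $r$ about $0$ in $\mathbb R^d$. *The affine model.* Write $a\in\mathbb R^{d'}$ as a vector $b_a\in\mathbb R^d$ together with $d^2-1$ numbers, which are the entries, other than the upper left one, of a matrix $A'_a\in\mathbb R^{d\times d}$; the upper left entry is determined by $\operatorname{tr}A'_a=0$. Let $R>1$ and let $0<\delta\le 1$ be so small that for every $a\in(-\delta,\delta)^{d'}$ there is $b'_a\in\mathbb R^d$ with $$\exp X_a=\begin{pmatrix}A_a&b_a\\0&1\end{pmatrix}\ \text{ for some matrix } A_a,\qquad X_a=\begin{pmatrix}A'_a&b'_a\\0&0\end{pmatrix},$$ and the affine maps $e^{tX_a}$, $0\le t\le 1$, send $B_{1/2}$ into $B_1$; fix such $b'_a$. For $a\in(-\delta,\delta)^{d'}$ let $Y_a$ be a divergence free vector field on $\mathbb R^d$,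 smooth in $(a,y)$, with $Y_a(y)=A'_ay+b'_a$ for $y\in B_1$ and $Y_a(y)=0$ for $|y|\ge r$, where $r<R$ does not depend on $a$. Let $\psi^a_t$ be its flow, smooth in $(a,t,y)$. *The perturbations.* Let $\phi_i:U_i'\to B_R$ $(1\le i\le j)$ be smooth charts of $M$ that carry $\mathrm{vol}_M$ to a positive constant multiple of Lebesgue measure, such that the sets $U_i=\phi_i^{-1}(B_{1/2})$ cover $M$. Let $g_i^a\in\mathrm{Diff}^\infty_{\mathrm{vol}}(M)$ be equal to $\phi_i^{-1}\circ\psi_1^a\circ\phi_i$ on $U_i'$ and to the identity outside $U_i'$. *The random walk.* Let $f_0\in\mathrm{Diff}^\infty_{\mathrm{vol}}(M)$, let $0<\varepsilon<\tfrac12$ with $\varepsilon<\delta$, let $p_0,\dots,p_j>0$ with $\sum_{i=0}^jp_i=1$, and let $\mu$ be the probability measure on $\mathrm{Diff}^\infty_{\mathrm{vol}}(M)$ $$\mu=C\Big(p_0\,\delta_{f_0}+\sum_{i=1}^jp_i\int_{[-\varepsilon,\varepsilon]^{d'}}\delta_{g_i^a\circ f_0}\,da\Big),$$ where $C>0$ is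 the normalizing constant. A Borel probability measure $\nu$ on $M$ is $\mu$-stationary if $\nu(B)=\int\nu(f^{-1}B)\,d\mu(f)$ for all Borel sets $B$. *Invariant structures.* Let $\mathbf{Gr}^k(TM)$ be the bundle of $k$-dimensional subspaces of the tangent spaces of $M$. A set $E\subseteq\mathbf{Gr}^k(TM)$, with fibres $E_x$, is a *$\mu$-invariant $\nu$-measurable algebraic structure* if 1. there is a Borel set $B\subseteq\mathbf{Gr}^k(TM)$ with $E_x=B_x$ for $\nu$-a.e. $x$; 2. for $\nu$-a.e. $x$, $E_x$ is an algebraic subset of $\mathbf{Gr}^k(T_xM)$, that is, one defined under the Plücker embedding by homogeneous polynomial equations on $\bigwedge^kT_xM$; 3. for $\mu$-a.e. $f$ and $\nu$-a.e. $x$, $E_{f(x)}=D_xf\,E_x$. It is *proper* if it is not true that for $\nu$-a.e. $x$ the fibre $E_x$ is either empty or all of $\mathbf{Gr}^k(T_xM)$; in particular, $E$ is proper if $\emptyset\ne E_x\ne\mathbf{Gr}^k(T_xM)$ for $\nu$-a.e. $x$. **Theorem.** Let $\nu$ be a $\mu$-stationary Borel probability measure on $M$ such that $\nu=\nu_0+\nu_\perp$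 with positive measures $\nu_0,\nu_\perp$, where $\nu_0\ll\mathrm{vol}_M$ and $\nu_0\ne0$. Then there is no proper $\mu$-invariant $\nu$-measurable algebraic structure in $\mathbf{Gr}^k(TM)$. -/

import Mathlib

open MeasureTheory Set
open scoped Manifold ContDiff Topology ENNReal NNReal

noncomputable section

namespace RandomWalk

/-! ### Grassmannians and their algebraic subsets -/

/-- The Grassmannian of `k`-dimensional linear subspaces of a real vector space `V`. -/
def Gr (k : ℕ) (V : Type*) [AddCommGroup V] [Module ℝ V] : Type _ :=
  {W : Submodule ℝ V // Module.finrank ℝ W = k}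

/-- The action of a linear isomorphism on `k`-dimensional subspaces. -/
def Gr.map {k : ℕ} {V V' : Type*} [AddCommGroup V] [Module ℝ V] [AddCommGroup V'] [Module ℝ V']
    (e : V ≃ₗ[ℝ] V') (W : Gr k V) : Gr k V' :=
  ⟨W.1.map (e : V →ₗ[ℝ] V'), (LinearEquiv.finrank_map_eq e W.1).trans W.2⟩

/-- A subset of the Grassmannian is algebraic if, under the Plücker embedding
`span (v₁, …, vₖ) ↦ [v₁ ∧ ⋯ ∧ vₖ]`, it is cut out by homogeneous polynomial equations on the
exterior power `⋀ᵏ V`. A polynomial function on `⋀ᵏ V` is written as a polynomial in the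
linear functionals on `⋀ᵏ V`. -/
def IsAlgebraicSubset {k : ℕ} {V : Type*} [AddCommGroup V] [Module ℝ V] (S : Set (Gr k V)) :
    Prop :=
  ∃ P : Set (MvPolynomial (Module.Dual ℝ (⋀[ℝ]^k V)) ℝ),
    (∀ q ∈ P, ∃ n : ℕ, q.IsHomogeneous n) ∧
    ∀ W : Gr k V, W ∈ S ↔
      ∀ v : Fin k → V, Submodule.span ℝ (Set.range v) = W.1 →
        ∀ q ∈ P, MvPolynomial.eval
          (fun l : Module.Dual ℝ (⋀[ℝ]^k V) => l (exteriorPower.ιMulti ℝ k v)) q = 0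

section Manifold

variable {d : ℕ} (k : ℕ) (M : Type*) [TopologicalSpace M]
  [ChartedSpace (EuclideanSpace ℝ (Fin d)) M] [IsManifold (𝓡 d) ∞ M]

/-- The bundle of `k`-frames: a base point `x` and `k` linearly independent vectors of `T_x M`. -/
structure FrameBundle where
  base : M
  frame : Fin k → TangentSpace (𝓡 d) base
  indep : LinearIndependent ℝ frame

/-- The Grassmannian bundle `Gr^k(TM)`: a base point `x` and a `k`-dimensional subspace
of `T_x M`. -/
structure GrBundle where
  base : M
  plane : Gr k (TangentSpace (𝓡 d) base)

variable {k M}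

/-- The subspace spanned by a frame. -/
def FrameBundle.toGr (p : FrameBundle (d := d) k M) : GrBundle (d := d) k M :=
  ⟨p.base, Submodule.span ℝ (Set.range p.frame), by
    rw [finrank_span_eq_card p.indep, Fintype.card_fin]⟩

/-- The frame bundle as a subspace of `M × (TM)ᵏ`. -/
instance : TopologicalSpace (FrameBundle (d := d) k M) :=
  TopologicalSpace.induced
    (fun p => ((p.base, fun i => ⟨p.base, p.frame i⟩) :
      M × (Fin k → TangentBundle (𝓡 d) M))) inferInstance

/-- The Grassmannian bundle carries the quotient topology from the frame bundle. -/
instance : TopologicalSpace (GrBundle (d := d) k M) :=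
  TopologicalSpace.coinduced FrameBundle.toGr inferInstance

instance : MeasurableSpace (GrBundle (d := d) k M) := borel _

instance : BorelSpace (GrBundle (d := d) k M) := ⟨rfl⟩

/-- The fibre `E_x` of a subset `E` of `Gr^k(TM)`. -/
def fiber (E : Set (GrBundle (d := d) k M)) (x : M) : Set (Gr k (TangentSpace (𝓡 d) x)) :=
  {W | (⟨x, W⟩ : GrBundle (d := d) k M) ∈ E}

/-- The action of the derivative `D_x f` on `k`-dimensional subspaces. -/
def grDeriv (f : M ≃ₘ⟮𝓡 d, 𝓡 d⟯ M) (x : M) :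
    Gr k (TangentSpace (𝓡 d) x) → Gr k (TangentSpace (𝓡 d) (f x)) :=
  Gr.map (f.mfderivToContinuousLinearEquiv (by simp) x).toLinearEquiv

/-! ### Riemannian volume and volume preserving diffeomorphisms -/

variable (M) in
/-- Smooth Riemannian metrics on `M`. -/
abbrev Metric : Type _ :=
  Bundle.ContMDiffRiemannianMetric (𝓡 d) ∞ (EuclideanSpace ℝ (Fin d))
    (fun x : M => TangentSpace (𝓡 d) x)

variable [MeasurableSpace M]

/-- The Gram matrix at the point with coordinates `y` of the coordinate vector fields of a
chart `e`. -/
def gram (G : Metric (d := d) M) (e : OpenPartialHomeomorph M (EuclideanSpace ℝ (Fin d)))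
    (y : EuclideanSpace ℝ (Fin d)) : Matrix (Fin d) (Fin d) ℝ :=
  Matrix.of fun i j =>
    G.inner (e.symm y)
      (mfderiv (𝓡 d) (𝓡 d) e.symm y (EuclideanSpace.single i (1 : ℝ)))
      (mfderiv (𝓡 d) (𝓡 d) e.symm y (EuclideanSpace.single j (1 : ℝ)))

/-- The measure `√(det g_{ij}) dy` of a chart, transported to the domain of the chart. -/
def chartVolume (G : Metric (d := d) M)
    (e : OpenPartialHomeomorph M (EuclideanSpace ℝ (Fin d))) : Measure M :=
  (((volume : Measure (EuclideanSpace ℝ (Fin d))).restrict e.target).withDensity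
    (fun y => ENNReal.ofReal (Real.sqrt (gram G e y).det))).map e.symm

/-- The Riemannian volume measure. The measures `√(det g_{ij}) dy` of two charts agree on the
overlap of their domains, and the least measure above all of them is the measure on `M` that
restricts to each of them on the domain of the chart. -/
def vol (G : Metric (d := d) M) : Measure M :=
  ⨆ x : M, chartVolume G (chartAt (EuclideanSpace ℝ (Fin d)) x)

/-- The group of smooth volume preserving diffeomorphisms of `M`. -/
def VolDiffeo (G : Metric (d := d) M) : Type _ :=
  {f : M ≃ₘ⟮𝓡 d, 𝓡 d⟯ M // MeasurePreserving f (vol G) (vol G)}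

instance (G : Metric (d := d) M) : CoeFun (VolDiffeo G) (fun _ => M → M) := ⟨fun f => f.1⟩

/-- `h.comp f` is `h ∘ f`. -/
def VolDiffeo.comp {G : Metric (d := d) M} (h f : VolDiffeo G) : VolDiffeo G :=
  ⟨f.1.trans h.1, h.2.comp f.2⟩

/-- The σ-algebra generated by the evaluations `f ↦ f x`. On a compact manifold it is the Borel
σ-algebra of the `C^∞` topology: that topology is Polish, the evaluations are continuous, and
countably many of them separate points. -/
instance (G : Metric (d := d) M) : MeasurableSpace (VolDiffeo G) :=
  ⨆ x : M, MeasurableSpace.comap (fun f : VolDiffeo G => f x) inferInstance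

/-! ### Stationary measures and invariant structures -/

/-- `ν` is `μ`-stationary: `μ ∗ ν = ν`, where `(μ ∗ ν)(B) = ∫ ν(f⁻¹ B) dμ(f)`. -/
def IsStationary {G : Metric (d := d) M} (μ : Measure (VolDiffeo G)) (ν : Measure M) : Prop :=
  ∀ B : Set M, MeasurableSet B → ∫⁻ f, ν (f ⁻¹' B) ∂μ = ν B

/-- A `μ`-invariant `ν`-measurable algebraic structure in `Gr^k(TM)`. -/
structure IsInvariantAlgebraicStructure {G : Metric (d := d) M} (μ : Measure (VolDiffeo G))
    (ν : Measure M) (E : Set (GrBundle (d := d) k M)) : Prop where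
  /-- Up to the fibres over a `ν`-null set, `E` is a Borel subset of `Gr^k(TM)`. -/
  measurable : ∃ B : Set (GrBundle (d := d) k M), MeasurableSet B ∧
    ∀ᵐ x ∂ν, fiber E x = fiber B x
  algebraic : ∀ᵐ x ∂ν, IsAlgebraicSubset (fiber E x)
  invariant : ∀ᵐ f ∂μ, ∀ᵐ x ∂ν, fiber E (f x) = grDeriv f.1 x '' fiber E x

/-- `E` is proper: it is not true that for `ν`-almost every `x` the fibre `E_x` is trivial, that
is, empty or the whole Grassmannian. In particular `E` is proper if almost every fibre is a
nonempty proper subset. -/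
def IsProper (ν : Measure M) (E : Set (GrBundle (d := d) k M)) : Prop :=
  ¬ ∀ᵐ x ∂ν, fiber E x = ∅ ∨ fiber E x = Set.univ

end Manifold

/-! ### The affine model -/

/-- The parameters `a = (a₁, …, a_d, a_{d+2}, …, a_{d²+d})`: a translation vector, and the entries
of a `d × d` matrix other than the upper left one. -/
abbrev Param (d : ℕ) : Type :=
  (Fin d → ℝ) × ({p : Fin d × Fin d // ¬ (p.1.val = 0 ∧ p.2.val = 0)} → ℝ)

/-- The cube `(-δ, δ)^{d'}`, with `d' = d² + d - 1`. -/
def openCube (d : ℕ) (δ : ℝ) : Set (Param d) :=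
  {a | (∀ i, |a.1 i| < δ) ∧ ∀ p, |a.2 p| < δ}

/-- The cube `[-ε, ε]^{d'}`, with `d' = d² + d - 1`. -/
def closedCube (d : ℕ) (ε : ℝ) : Set (Param d) :=
  {a | (∀ i, |a.1 i| ≤ ε) ∧ ∀ p, |a.2 p| ≤ ε}

/-- The vector `b_a`. -/
def translationPart {d : ℕ} (a : Param d) : EuclideanSpace ℝ (Fin d) := WithLp.toLp 2 a.1

/-- The trace-free matrix `A'_a`: its upper left entry is minus the sum of the other diagonal
entries, and its remaining entries are free. -/
def linearPart {d : ℕ} (a : Param d) : Matrix (Fin d) (Fin d) ℝ :=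
  Matrix.of fun i j =>
    if h : i.val = 0 ∧ j.val = 0 then
      - ∑ l : {l : Fin d // l.val ≠ 0}, a.2 ⟨(l.1, l.1), fun hl => l.2 hl.1⟩
    else a.2 ⟨(i, j), h⟩

/-- The block matrix `(A' b'; 0 0)`, an element of the Lie algebra of the affine group. -/
def affineLie {d : ℕ} (A' : Matrix (Fin d) (Fin d) ℝ) (b' : EuclideanSpace ℝ (Fin d)) :
    Matrix (Fin d ⊕ Unit) (Fin d ⊕ Unit) ℝ :=
  Matrix.fromBlocks A' (Matrix.of fun i _ => b' i) 0 0

/-- The action `y ↦ A y + b` on `ℝ^d` of a block matrix `(A b; 0 1)`. -/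
def affineAct {d : ℕ} (T : Matrix (Fin d ⊕ Unit) (Fin d ⊕ Unit) ℝ)
    (y : EuclideanSpace ℝ (Fin d)) : EuclideanSpace ℝ (Fin d) :=
  WithLp.toLp 2 fun i => (∑ j, T (Sum.inl i) (Sum.inl j) * y j) + T (Sum.inl i) (Sum.inr ())

/-- The maps `ψ_t^a` of `ℝ^d`, for parameters `a` in the cube `(-δ, δ)^{d'}`: the flows of
divergence free vector fields `Y_a` which are supported in the ball of radius `R` and agree on the
unit ball with the affine vector field `X_a`, the logarithm of an affine map with
translation part `b_a`. -/
structure CutoffAffineFlow (d : ℕ) (R δ : ℝ) where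
  /-- `b'_a`, so that `X_a = (A'_a b'_a; 0 0)`. -/
  b' : Param d → EuclideanSpace ℝ (Fin d)
  /-- `exp X_a = (A_a b_a; 0 1)` for some matrix `A_a`. -/
  exp_eq : ∀ a ∈ openCube d δ, ∃ A : Matrix (Fin d) (Fin d) ℝ,
    NormedSpace.exp (affineLie (linearPart a) (b' a)) =
      Matrix.fromBlocks A (Matrix.of fun i _ => translationPart a i) 0 1
  /-- The parameters are so small that the affine flow moves the ball of radius `1/2` inside
  the unit ball up to time one. -/
  small : ∀ a ∈ openCube d δ, ∀ t ∈ Set.Icc (0 : ℝ) 1,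
    ∀ y ∈ Metric.ball (0 : EuclideanSpace ℝ (Fin d)) (1 / 2),
      affineAct (NormedSpace.exp (t • affineLie (linearPart a) (b' a))) y ∈
        Metric.ball (0 : EuclideanSpace ℝ (Fin d)) 1
  /-- The vector fields `Y_a`. -/
  Y : Param d → EuclideanSpace ℝ (Fin d) → EuclideanSpace ℝ (Fin d)
  Y_smooth : ContDiffOn ℝ ∞ (fun p : Param d × EuclideanSpace ℝ (Fin d) => Y p.1 p.2)
    (openCube d δ ×ˢ Set.univ)
  Y_div : ∀ a ∈ openCube d δ, ∀ y, LinearMap.trace ℝ (EuclideanSpace ℝ (Fin d))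
    (fderiv ℝ (Y a) y : EuclideanSpace ℝ (Fin d) →ₗ[ℝ] EuclideanSpace ℝ (Fin d)) = 0
  Y_eq : ∀ a ∈ openCube d δ, ∀ y ∈ Metric.ball (0 : EuclideanSpace ℝ (Fin d)) 1,
    Y a y = affineAct (affineLie (linearPart a) (b' a)) y
  Y_supp : ∃ r < R, ∀ a ∈ openCube d δ, ∀ y : EuclideanSpace ℝ (Fin d), r ≤ ‖y‖ → Y a y = 0
  /-- `ψ a t` is the time `t` map of the flow of `Y_a`. -/
  ψ : Param d → ℝ → EuclideanSpace ℝ (Fin d) → EuclideanSpace ℝ (Fin d)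
  ψ_smooth : ContDiffOn ℝ ∞
    (fun p : Param d × ℝ × EuclideanSpace ℝ (Fin d) => ψ p.1 p.2.1 p.2.2)
    (openCube d δ ×ˢ Set.univ)
  ψ_zero : ∀ a ∈ openCube d δ, ∀ y, ψ a 0 y = y
  ψ_deriv : ∀ a ∈ openCube d δ, ∀ y t, HasDerivAt (fun s => ψ a s y) (Y a (ψ a t y)) t

/-! ### The perturbations of the manifold and the law of the random walk -/

section Law

variable {d : ℕ} {M : Type*} [TopologicalSpace M]
  [ChartedSpace (EuclideanSpace ℝ (Fin d)) M] [IsManifold (𝓡 d) ∞ M] [MeasurableSpace M]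

/-- A Moser chart: a smooth chart onto the ball of radius `R` in which the Riemannian volume is a
constant multiple of Lebesgue measure. -/
structure MoserChart (G : Metric (d := d) M) (R : ℝ) where
  chart : OpenPartialHomeomorph M (EuclideanSpace ℝ (Fin d))
  smooth : chart ∈ IsManifold.maximalAtlas (𝓡 d) ∞ M
  target_eq : chart.target = Metric.ball 0 R
  map_vol : ∃ c : ℝ≥0, c ≠ 0 ∧ ((vol G).restrict chart.source).map chart =
    c • (volume : Measure (EuclideanSpace ℝ (Fin d))).restrict (Metric.ball 0 R)

/-- The neighbourhood `U` of the centre of a Moser chart: the preimage of the ball of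
radius `1/2`. -/
def MoserChart.inner {G : Metric (d := d) M} {R : ℝ} (φ : MoserChart G R) : Set M :=
  φ.chart.source ∩ φ.chart ⁻¹' Metric.ball 0 (1 / 2)

/-- Finitely many families `g_i^a` of volume preserving diffeomorphisms: `g_i^a` is
`φ_i⁻¹ ∘ ψ_1^a ∘ φ_i` on the domain of the Moser chart `φ_i`, and the identity elsewhere; the
neighbourhoods `U_i` cover `M`. -/
structure Perturbations (G : Metric (d := d) M) (n : ℕ) where
  R : ℝ
  one_lt_R : 1 < R
  δ : ℝ
  δ_pos : 0 < δ
  δ_le_one : δ ≤ 1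
  flow : CutoffAffineFlow d R δ
  φ : Fin n → MoserChart G R
  cover : ∀ x : M, ∃ i, x ∈ (φ i).inner
  g : Fin n → Param d → VolDiffeo G
  g_eq : ∀ i, ∀ a ∈ openCube d δ, ∀ x ∈ (φ i).chart.source,
    g i a x = (φ i).chart.symm (flow.ψ a 1 ((φ i).chart x))
  g_eq_id : ∀ i, ∀ a ∈ openCube d δ, ∀ x ∉ (φ i).chart.source, g i a x = x

/-- The measure `p₀ δ_{f₀} + ∑ᵢ pᵢ ∫ δ_{gᵢᵃ ∘ f₀} da`, the integrals being over the
cube `[-ε, ε]^{d'}`. -/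
def preLaw {G : Metric (d := d) M} {n : ℕ} (D : Perturbations G n) (f₀ : VolDiffeo G)
    (ε : ℝ) (p₀ : ℝ≥0) (p : Fin n → ℝ≥0) : Measure (VolDiffeo G) :=
  p₀ • Measure.dirac f₀ + ∑ i, p i •
    ((volume : Measure (Param d)).restrict (closedCube d ε)).map (fun a => (D.g i a).comp f₀)

/-- The law `μ` of the random walk: the measure above, normalized to be a probability measure. -/
def law {G : Metric (d := d) M} {n : ℕ} (D : Perturbations G n) (f₀ : VolDiffeo G)
    (ε : ℝ) (p₀ : ℝ≥0) (p : Fin n → ℝ≥0) : Measure (VolDiffeo G) :=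
  (preLaw D f₀ ε p₀ p Set.univ)⁻¹ • preLaw D f₀ ε p₀ p

end Law

end RandomWalk

end

noncomputable section

namespace RandomWalk

/-! Since $f_0$ is an atom of $\mu$, invariance under $f_0$ and under $g_i^a\circ f_0$ gives
$E_{g_i^az}=D_zg_i^a\,E_z$ at $z=f_0(x)$ for almost every $a$. If $z\in U_i$, then $g_i^a$ is
$y\mapsto e^{A'}y+b$ in the chart, so the fibre at the end point $w=e^{A'}y+b$ is $e^{A'}E_y$. The
shear that replaces $b$ by $w$ preserves Lebesgue measure, so by Fubini a single $w$ is reached with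
almost every small trace-free $A'$ (`exists_endpoint`). Comparing two of these shows that
$e^{-A_0'}e^{A'}$ maps $E_y$ into itself. Membership in an algebraic set is a closed condition, so
$e^{A'}E_y\subseteq E_y$ for all small $A'$. The small transvections are among these exponentials,
their iterates give every transvection, and transvections carry any $k$-plane to any other. Hence
$E_y$ is empty or everything (`IsAlgebraicSubset.eq_empty_or_univ_of_ae`), and invariance under
$f_0$ brings this back to $E_x$.

Two measure-theoretic points support this. Invariance is given for almost every $x$ after $a$ is
fixed, while the argument fixes $x$ first. The bad pairs $(a,x)$ are those for which some frame
violates the relation; they come from a projection of a Borel set, which is analytic and so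
universally measurable, and Fubini applies (`ae_ae_swap_of_forall_notMem`). Stationarity makes
almost sure properties of $E$ hold at the image points $f(x)$ too (`IsStationary.ae_ae`), so that
$E$ may be replaced there by its Borel version. -/

/-! ### Analytic sets are null measurable -/

/-- A set of sequences that meets every cylinder `{x | ∀ i < n, x i ≤ m i}` in a closed set meets
the box `{x | ∀ i, x i ≤ m i}`. -/
theorem exists_mem_box_of_forall_cylinder {C : Set (ℕ → ℕ)} (hC : IsClosed C) (m : ℕ → ℕ)
    (h : ∀ n, ∃ x ∈ C, ∀ i < n, x i ≤ m i) : ∃ x ∈ C, ∀ i, x i ≤ m i := by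
  choose x hxC hxm using h
  have hK : IsCompact (Set.pi univ fun i => Iic (m i)) :=
    isCompact_univ_pi fun i => (finite_Iic (m i)).isCompact
  -- Truncation by `m` puts the points into the compact box. It leaves coordinate `i` of the `n`-th
  -- point alone once `i < n`, so the original subsequence has the same limit.
  obtain ⟨y, hy, φ, hφ, hlim⟩ := hK.tendsto_subseq (x := fun n i => min (x n i) (m i))
    (fun n i _ => mem_Iic.2 (min_le_right _ _))
  refine ⟨y, hC.mem_of_tendsto (b := Filter.atTop) (f := fun n => x (φ n)) ?_
    (Filter.Eventually.of_forall fun n => hxC _), fun i => hy i (mem_univ i)⟩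
  rw [tendsto_pi_nhds] at hlim ⊢
  intro i
  refine (hlim i).congr' ?_
  filter_upwards [hφ.tendsto_atTop.eventually_gt_atTop i] with n hn
  exact min_eq_left (hxm _ i hn)

/-- Inner regularity of a finite measure on an analytic set. -/
theorem exists_isClosed_subset_range_lt_measure {X : Type*} [TopologicalSpace X] [T2Space X]
    [MeasurableSpace X] [OpensMeasurableSpace X] (μ : Measure X) [IsFiniteMeasure μ]
    {f : (ℕ → ℕ) → X} (hf : Continuous f) {c : ℝ≥0∞} (hc : c < μ (range f)) :
    ∃ K ⊆ range f, IsClosed K ∧ c ≤ μ K := by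
  let cyl : List ℕ → Set (ℕ → ℕ) := fun l => {x | ∀ i (h : i < l.length), x i ≤ l[i]}
  -- The cylinder images increase to the previous one as the new bound grows, so a strict lower
  -- bound on the measure survives for some finite bound.
  have step : ∀ l : List ℕ, c < μ (f '' cyl l) → ∃ m, c < μ (f '' cyl (l ++ [m])) := by
    intro l hl
    have hU : f '' cyl l = ⋃ m, f '' cyl (l ++ [m]) := by
      rw [← image_iUnion]
      congr 1
      ext x
      simp only [cyl, mem_ofPred_eq, mem_iUnion]
      constructor
      · intro h
        refine ⟨x l.length, fun i hi => ?_⟩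
        rcases lt_or_ge i l.length with h1 | h1
        · rw [List.getElem_append_left h1]; exact h i h1
        · have : i = l.length := by simp at hi; omega
          subst this; simp
      · rintro ⟨m, h⟩ i hi
        have := h i (by simp; omega)
        rwa [List.getElem_append_left hi] at this
    have hmono : Monotone fun m => f '' cyl (l ++ [m]) := by
      intro a b hab
      refine image_mono fun x hx i hi => (hx i (by simpa using hi)).trans ?_
      rcases lt_or_ge i l.length with h1 | h1
      · rw [List.getElem_append_left h1, List.getElem_append_left h1]
      · have : i = l.length := by simp at hi; omega
        subst this; simpa using hab
    rw [hU, hmono.directed_le.measure_iUnion] at hl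
    exact lt_iSup_iff.1 hl
  choose! next hnext using step
  let L : ℕ → List ℕ := fun n => Nat.rec [] (fun _ l => l ++ [next l]) n
  have hL : ∀ n, c < μ (f '' cyl (L n)) := by
    intro n
    induction n with
    | zero => simpa [L, cyl] using hc
    | succ n ih => exact hnext _ ih
  have hlen : ∀ n, (L n).length = n := by
    intro n
    induction n with
    | zero => rfl
    | succ n ih => simp [L] at ih ⊢; exact ih
  let m : ℕ → ℕ := fun n => next (L n)
  have hget : ∀ n i (h : i < (L n).length), (L n)[i] = m i := by
    intro n
    induction n with
    | zero => intro i h; simp [L] at h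
    | succ n ih =>
      intro i h
      have e : L (n + 1) = L n ++ [next (L n)] := rfl
      simp only [e]
      rcases lt_or_ge i (L n).length with h1 | h1
      · rw [List.getElem_append_left h1]; exact ih i h1
      · have : i = (L n).length := by simp [e] at h; omega
        have h2 : i = n := by rw [this, hlen]
        rw [List.getElem_append_right h1]
        simp [m, h2]
  have hcyl : ∀ n, cyl (L n) = {x | ∀ i < n, x i ≤ m i} := by
    intro n
    ext x
    simp only [cyl, mem_ofPred_eq]
    constructor
    · intro h i hi
      have hi' : i < (L n).length := by rwa [hlen]
      rw [← hget n i hi']; exact h i hi'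
    · intro h i hi
      rw [hget n i hi]; exact h i (by rwa [hlen] at hi)
  let K : Set (ℕ → ℕ) := Set.pi univ fun i => Iic (m i)
  have hK : IsCompact K := isCompact_univ_pi fun i => (finite_Iic (m i)).isCompact
  refine ⟨f '' K, image_subset_range _ _, (hK.image hf).isClosed, ?_⟩
  -- A point outside the compact image can be separated from it by open sets; each cylinder then has
  -- a point mapped outside `V`, and by compactness so does the box itself.
  have hsub : (⋂ n, closure (f '' cyl (L n))) ⊆ f '' K := by
    intro y hy
    by_contra hyK
    obtain ⟨U, V, hU, hV, hyU, hKV, hUV⟩ := SeparatedNhds.of_isCompact_isCompact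
      (isCompact_singleton (x := y)) (hK.image hf) (disjoint_singleton_left.2 hyK)
    obtain ⟨x, hx, hxm⟩ := exists_mem_box_of_forall_cylinder
      (C := (f ⁻¹' V)ᶜ) (hV.preimage hf).isClosed_compl m fun n => by
        have := mem_closure_iff.1 (mem_iInter.1 hy n) U hU (hyU rfl)
        obtain ⟨_, hzU, x, hx, rfl⟩ := this
        rw [hcyl] at hx
        exact ⟨x, fun hxV => disjoint_left.1 hUV hzU hxV, hx⟩
    exact hx (hKV ⟨x, fun i _ => hxm i, rfl⟩)
  refine le_trans ?_ (measure_mono hsub)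
  have hanti : Antitone fun n => closure (f '' cyl (L n)) := by
    intro a b hab
    refine closure_mono (image_mono ?_)
    rw [hcyl, hcyl]
    exact fun x hx i hi => hx i (hi.trans_le hab)
  rw [hanti.directed_ge.measure_iInter
    (fun n => isClosed_closure.measurableSet.nullMeasurableSet) ⟨0, measure_ne_top _ _⟩]
  exact le_iInf fun n => (hL n).le.trans (measure_mono subset_closure)

/-- Analytic sets are universally measurable. -/
theorem nullMeasurableSet_of_analyticSet {X : Type*} [TopologicalSpace X] [T2Space X]
    [MeasurableSpace X] [OpensMeasurableSpace X] (μ : Measure X) [IsFiniteMeasure μ]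
    {s : Set X} (hs : AnalyticSet s) : NullMeasurableSet s μ := by
  rw [AnalyticSet] at hs
  rcases hs with rfl | ⟨f, hf, rfl⟩
  · exact MeasurableSet.empty.nullMeasurableSet
  rcases eq_or_ne (μ (range f)) 0 with h0 | h0
  · exact NullMeasurableSet.of_null h0
  obtain ⟨u, -, hu, hlim⟩ := exists_seq_strictMono_tendsto' (pos_iff_ne_zero.2 h0)
  choose K hKs hKc hK using fun n =>
    exists_isClosed_subset_range_lt_measure μ hf (hu n).2
  have hm : MeasurableSet (⋃ n, K n) := .iUnion fun n => (hKc n).measurableSet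
  have hsub : (⋃ n, K n) ⊆ range f := iUnion_subset hKs
  refine hm.nullMeasurableSet.congr (ae_eq_of_subset_of_measure_ge hsub ?_
    hm.nullMeasurableSet (measure_ne_top _ _))
  exact le_of_tendsto' hlim fun n => (hK n).trans (measure_mono (subset_iUnion K n))

/-- The projection of a Borel set is null measurable. -/
theorem nullMeasurableSet_setOf_exists {X Y : Type*} [TopologicalSpace X] [PolishSpace X]
    [MeasurableSpace X] [BorelSpace X] [TopologicalSpace Y] [PolishSpace Y] [MeasurableSpace Y]
    [BorelSpace Y] (μ : Measure X) [IsFiniteMeasure μ] {s : Set (X × Y)} (hs : MeasurableSet s) :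
    NullMeasurableSet {x | ∃ y, (x, y) ∈ s} μ := by
  have : {x | ∃ y, (x, y) ∈ s} = Prod.fst '' s := by ext; simp
  rw [this]
  exact nullMeasurableSet_of_analyticSet μ (hs.analyticSet.image_of_continuous continuous_fst)

/-! ### The cut off affine flows -/

section AffineModel

variable {d : ℕ}

/-- The linear part `A_a = exp A'_a` of the affine map. -/
def expLinear (m : {p : Fin d × Fin d // ¬ (p.1.val = 0 ∧ p.2.val = 0)} → ℝ) :
    Matrix (Fin d) (Fin d) ℝ :=
  NormedSpace.exp (linearPart ((0, m) : Param d))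

theorem linearPart_eq (a : Param d) : linearPart a = linearPart ((0, a.2) : Param d) := rfl

theorem continuous_linearPart : Continuous (linearPart : Param d → Matrix (Fin d) (Fin d) ℝ) := by
  refine continuous_matrix fun i j => ?_
  by_cases h : i.val = 0 ∧ j.val = 0
  · simp only [linearPart, Matrix.of_apply, h, and_self, dif_pos]
    fun_prop
  · simp only [linearPart, Matrix.of_apply, h, dif_neg, not_false_eq_true]
    fun_prop

/-! ### Exponentials of matrices. -/

section
attribute [local instance] Matrix.linftyOpNormedRing Matrix.linftyOpNormedAlgebra

/-- The matrix norm only gives access to the Banach algebra facts; its topology is the entrywise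
one. -/
theorem continuous_matrix_exp {m : Type*} [Fintype m] [DecidableEq m] :
    Continuous (NormedSpace.exp : Matrix m m ℝ → Matrix m m ℝ) :=
  NormedSpace.exp_continuous

theorem hasDerivAt_matrix_exp {m : Type*} [Fintype m] [DecidableEq m] (X : Matrix m m ℝ) (t : ℝ) :
    HasDerivAt (fun u : ℝ => NormedSpace.exp (u • X)) (X * NormedSpace.exp (t • X)) t :=
  hasDerivAt_exp_smul_const' X t

theorem hasSum_matrix_exp {m : Type*} [Fintype m] [DecidableEq m] (X : Matrix m m ℝ) :
    HasSum (fun n : ℕ => ((n.factorial : ℝ)⁻¹) • X ^ n) (NormedSpace.exp X) :=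
  NormedSpace.exp_series_hasSum_exp' X

end

theorem continuous_expLinear : Continuous (expLinear (d := d)) :=
  continuous_matrix_exp.comp (continuous_linearPart.comp (by fun_prop))

theorem expLinear_zero : expLinear (d := d) 0 = 1 := by
  have : linearPart ((0, 0) : Param d) = 0 := by
    ext i j
    simp [linearPart]
  rw [expLinear, this, NormedSpace.exp_zero]

theorem isUnit_expLinear (m : {p : Fin d × Fin d // ¬ (p.1.val = 0 ∧ p.2.val = 0)} → ℝ) :
    IsUnit (expLinear m) :=
  Matrix.isUnit_exp _

/-- The zeroth power is excluded because its lower right entry is 1. The column `c` plays no role in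
the exponential's linear block or bottom row. -/
theorem affineLie_pow_succ (A' : Matrix (Fin d) (Fin d) ℝ) (b' : EuclideanSpace ℝ (Fin d))
    (n : ℕ) : ∃ c : Matrix (Fin d) Unit ℝ,
      affineLie A' b' ^ (n + 1) = Matrix.fromBlocks (A' ^ (n + 1)) c 0 0 := by
  induction n with
  | zero => exact ⟨_, by rw [zero_add, pow_one, pow_one]; rfl⟩
  | succ n ih =>
    obtain ⟨c, hc⟩ := ih
    refine ⟨A' ^ (n + 1) * (Matrix.of fun i _ => b' i), ?_⟩
    rw [pow_succ, hc, affineLie, Matrix.fromBlocks_multiply, pow_succ A' (n + 1)]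
    simp

theorem toBlocks₁₁_exp_affineLie (A' : Matrix (Fin d) (Fin d) ℝ) (b' : EuclideanSpace ℝ (Fin d)) :
    (NormedSpace.exp (affineLie A' b')).toBlocks₁₁ = NormedSpace.exp A' := by
  have h1 := hasSum_matrix_exp (affineLie A' b')
  have h2 := hasSum_matrix_exp A'
  have hf : ∀ n : ℕ, (((n.factorial : ℝ)⁻¹) • affineLie A' b' ^ n).toBlocks₁₁
      = ((n.factorial : ℝ)⁻¹) • A' ^ n := by
    intro n
    rcases n with _ | n
    · ext i j
      simp [Matrix.toBlocks₁₁, Matrix.one_apply]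
    · obtain ⟨c, hc⟩ := affineLie_pow_succ A' b' n
      rw [hc]
      ext i j
      simp [Matrix.toBlocks₁₁]
  let g : Matrix (Fin d ⊕ Unit) (Fin d ⊕ Unit) ℝ →+ Matrix (Fin d) (Fin d) ℝ :=
    { toFun := Matrix.toBlocks₁₁, map_zero' := rfl, map_add' := fun _ _ => rfl }
  have hg : Continuous g := by
    refine continuous_matrix fun i j => ?_
    exact (continuous_apply_apply (Sum.inl i) (Sum.inl j))
  have h3 := h1.map g hg
  refine h3.unique ?_
  convert h2 using 1
  exact funext hf

/-- Only the zeroth term of the series has a nonzero bottom row. This makes the exponential a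
genuine affine map. -/
theorem exp_affineLie_inr (A' : Matrix (Fin d) (Fin d) ℝ) (b' : EuclideanSpace ℝ (Fin d))
    (s : Fin d ⊕ Unit) : NormedSpace.exp (affineLie A' b') (Sum.inr ()) s =
      (1 : Matrix (Fin d ⊕ Unit) (Fin d ⊕ Unit) ℝ) (Sum.inr ()) s := by
  have h1 := hasSum_matrix_exp (affineLie A' b')
  have h2 := Pi.hasSum.1 (Pi.hasSum.1 h1 (Sum.inr ())) s
  refine h2.unique ?_
  convert hasSum_single 0 ?_ using 1
  · simp
  · intro n hn
    obtain ⟨n, rfl⟩ := Nat.exists_eq_succ_of_ne_zero hn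
    obtain ⟨c, hc⟩ := affineLie_pow_succ A' b' n
    rw [Nat.succ_eq_add_one, hc]
    rcases s with s | s <;> simp

/-- The bottom row `(0 1)` of the second factor turns the matrix product into composition. This
identifies the velocity of the affine curve with the affine field at its current point. -/
theorem affineAct_affineLie_mul_exp (A' : Matrix (Fin d) (Fin d) ℝ)
    (b' : EuclideanSpace ℝ (Fin d)) (t : ℝ) (y : EuclideanSpace ℝ (Fin d)) :
    affineAct (affineLie A' b' * NormedSpace.exp (t • affineLie A' b')) y =
      affineAct (affineLie A' b') (affineAct (NormedSpace.exp (t • affineLie A' b')) y) := by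
  have hsmul : t • affineLie A' b' = affineLie (t • A') (t • b') := by
    rw [affineLie, affineLie, Matrix.fromBlocks_smul]
    congr 1 <;> simp
  have h := exp_affineLie_inr (t • A') (t • b')
  rw [← hsmul] at h
  set T := NormedSpace.exp (t • affineLie A' b')
  have h1 : ∀ j, T (Sum.inr ()) (Sum.inl j) = 0 := fun j => by rw [h]; simp
  have h2 : T (Sum.inr ()) (Sum.inr ()) = 1 := by rw [h]; simp
  ext i
  simp only [affineAct, Matrix.mul_apply, Fintype.sum_sum_type, affineLie,
    Matrix.fromBlocks_apply₁₁, Matrix.fromBlocks_apply₁₂, Matrix.of_apply, Finset.univ_unique,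
    Finset.sum_singleton, PUnit.default_eq_unit, h1, h2, mul_zero, add_zero, mul_one, mul_add,
    Finset.sum_add_distrib, Finset.mul_sum, Finset.sum_mul]
  rw [Finset.sum_comm, add_assoc]
  simp only [mul_assoc]

/-- The affine map `y ↦ A_a y + b_a`. -/
def affineMap (a : Param d) (y : EuclideanSpace ℝ (Fin d)) : EuclideanSpace ℝ (Fin d) :=
  WithLp.toLp 2 ((expLinear a.2).mulVec y.ofLp + a.1)

theorem continuous_affineMap :
    Continuous fun p : Param d × EuclideanSpace ℝ (Fin d) => affineMap p.1 p.2 := by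
  unfold affineMap
  have := continuous_expLinear (d := d)
  fun_prop

/-- Eliminates `b'`: the last column of the exponential is prescribed to be $b_a$, and its linear
block is $e^{A'_a}$. -/
theorem affineAct_exp {R δ : ℝ} (F : CutoffAffineFlow d R δ) {a : Param d} (ha : a ∈ openCube d δ)
    (y : EuclideanSpace ℝ (Fin d)) :
    affineAct (NormedSpace.exp (affineLie (linearPart a) (F.b' a))) y = affineMap a y := by
  obtain ⟨A, hA⟩ := F.exp_eq a ha
  have h := toBlocks₁₁_exp_affineLie (linearPart a) (F.b' a)
  rw [hA, Matrix.toBlocks_fromBlocks₁₁] at h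
  rw [hA, h]
  ext i
  simp [affineAct, affineMap, expLinear, linearPart_eq a, translationPart, Matrix.mulVec,
    dotProduct]

/-! ### Time one maps of the cut off flows. -/

theorem CutoffAffineFlow.exists_lipschitzWith {R δ : ℝ} (F : CutoffAffineFlow d R δ)
    {a : Param d} (ha : a ∈ openCube d δ) : ∃ K, LipschitzWith K (F.Y a) := by
  obtain ⟨r, -, hr⟩ := F.Y_supp
  have hs : HasCompactSupport (F.Y a) :=
    HasCompactSupport.intro (isCompact_closedBall 0 r) fun y hy => hr a ha y (by
      simp at hy; exact hy.le)
  have hc : ContDiff ℝ ∞ (F.Y a) := by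
    rw [← contDiffOn_univ]
    exact F.Y_smooth.comp (contDiff_prodMk_right a).contDiffOn fun y _ => ⟨ha, mem_univ _⟩
  exact hc.lipschitzWith_of_hasCompactSupport hs (by simp)

/-- On the ball of radius `1/2` the time one map is affine. -/
theorem CutoffAffineFlow.ψ_one_eq {R δ : ℝ} (F : CutoffAffineFlow d R δ)
    {a : Param d} (ha : a ∈ openCube d δ) {y : EuclideanSpace ℝ (Fin d)}
    (hy : y ∈ Metric.ball 0 (1 / 2)) : F.ψ a 1 y = affineMap a y := by
  obtain ⟨K, hK⟩ := F.exists_lipschitzWith ha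
  set X := affineLie (linearPart a) (F.b' a) with hX
  have hder : ∀ t : ℝ, HasDerivAt (fun s : ℝ => affineAct (NormedSpace.exp (s • X)) y)
      (affineAct (X * NormedSpace.exp (t • X)) y) t := by
    intro t
    have h := hasDerivAt_matrix_exp X t
    have he : ∀ i j, HasDerivAt (fun s : ℝ => NormedSpace.exp (s • X) i j)
      ((X * NormedSpace.exp (t • X)) i j) t := fun i j =>
        (hasDerivAt_pi.1 ((hasDerivAt_pi.1 h) i)) j
    have hp : HasDerivAt (fun s : ℝ => fun i => (∑ j, NormedSpace.exp (s • X) (Sum.inl i)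
        (Sum.inl j) * y j) + NormedSpace.exp (s • X) (Sum.inl i) (Sum.inr ()))
        (fun i => (∑ j, (X * NormedSpace.exp (t • X)) (Sum.inl i) (Sum.inl j) * y j) +
          (X * NormedSpace.exp (t • X)) (Sum.inl i) (Sum.inr ())) t := by
      rw [hasDerivAt_pi]
      intro i
      exact (HasDerivAt.fun_sum fun j _ => (he _ _).mul_const _).add (he _ _)
    exact (PiLp.hasFDerivAt_toLp 2 _).comp_hasDerivAt t hp
  -- `small` keeps the affine curve in the unit ball on `[0, 1]`, where `Y` is the affine field;
  -- uniqueness for the Lipschitz field then identifies it with the flow line.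
  have hsol : ∀ t ∈ Icc (0 : ℝ) 1, HasDerivAt (fun s : ℝ => affineAct (NormedSpace.exp (s • X)) y)
      (F.Y a (affineAct (NormedSpace.exp (t • X)) y)) t := by
    intro t ht
    rw [F.Y_eq a ha _ (F.small a ha t ht y hy), ← affineAct_affineLie_mul_exp]
    exact hder t
  have h := ODE_solution_unique_of_mem_Icc_right (v := fun _ => F.Y a) (s := fun _ => univ)
    (K := K) (a := 0) (b := 1) (f := fun t => F.ψ a t y)
    (g := fun t : ℝ => affineAct (NormedSpace.exp (t • X)) y)
    (fun _ _ => hK.lipschitzOnWith)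
    (fun t _ => (F.ψ_deriv a ha y t).continuousAt.continuousWithinAt)
    (fun t _ => (F.ψ_deriv a ha y t).hasDerivWithinAt) (fun _ _ => mem_univ _)
    (fun t _ => (hder t).continuousAt.continuousWithinAt)
    (fun t ht => (hsol t (Ico_subset_Icc_self ht)).hasDerivWithinAt) (fun _ _ => mem_univ _)
    (by
      simp only [F.ψ_zero a ha, zero_smul, NormedSpace.exp_zero]
      ext i
      simp [affineAct, Matrix.one_apply])
  have h1 := h (right_mem_Icc.2 zero_le_one)
  simp only [one_smul] at h1
  rw [h1, affineAct_exp F ha]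

/-- A flow line ending outside the ball ends at a zero of the field, so by uniqueness it is constant
and also started outside. -/
theorem CutoffAffineFlow.ψ_one_mem_ball {R δ : ℝ} (F : CutoffAffineFlow d R δ)
    {a : Param d} (ha : a ∈ openCube d δ) {y : EuclideanSpace ℝ (Fin d)}
    (hy : y ∈ Metric.ball 0 R) : F.ψ a 1 y ∈ Metric.ball 0 R := by
  obtain ⟨K, hK⟩ := F.exists_lipschitzWith ha
  obtain ⟨r, hrR, hr⟩ := F.Y_supp
  by_contra h
  have hn : r ≤ ‖F.ψ a 1 y‖ := by simp at h; linarith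
  have := ODE_solution_unique_univ (v := fun _ => F.Y a) (s := fun _ => univ) (K := K) (t₀ := 1)
    (f := fun t => F.ψ a t y) (g := fun _ => F.ψ a 1 y) (fun _ => hK.lipschitzOnWith)
    (fun t => ⟨F.ψ_deriv a ha y t, mem_univ _⟩)
    (fun t => ⟨by rw [hr a ha _ hn]; exact hasDerivAt_const _ _, mem_univ _⟩) rfl
  have h0 := congrFun this 0
  simp only [F.ψ_zero a ha] at h0
  rw [← h0] at h
  exact h hy

end AffineModel

/-! ### Algebraic subsets of the Grassmannian -/

section Grassmannian

variable {k : ℕ} {V : Type*}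

/-- Expand in a basis. Continuity is tested on linear functionals because `V` carries no topology;
it will be a tangent space. -/
theorem continuous_multilinearMap_apply [AddCommGroup V] [Module ℝ V] [FiniteDimensional ℝ V]
    {X : Type*} [TopologicalSpace X] (φ : MultilinearMap ℝ (fun _ : Fin k => V) ℝ)
    {v : X → Fin k → V} (hv : ∀ (l : Module.Dual ℝ V) (i : Fin k), Continuous fun x => l (v x i)) :
    Continuous fun x => φ (v x) := by
  let b := Module.finBasis ℝ V
  have : (fun x => φ (v x)) = fun x => ∑ r : Fin k → Fin (Module.finrank ℝ V),
      (∏ i, b.coord (r i) (v x i)) • φ fun i => b (r i) := by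
    ext x
    conv_lhs => rw [show v x = fun i => ∑ j, b.coord j (v x i) • b j from
      funext fun i => (b.sum_repr (v x i)).symm]
    rw [MultilinearMap.map_sum]
    exact Finset.sum_congr rfl fun r _ => φ.map_smul_univ _ _
  rw [this]
  exact continuous_finsetSum _ fun r _ => Continuous.fun_smul
    (continuous_finsetProd _ fun i _ => hv _ _) continuous_const

/-- If `T` depends continuously on a parameter then `T W ∈ S` is a closed condition, for an
algebraic set `S`. -/
theorem IsAlgebraicSubset.isClosed_setOf_map_mem [AddCommGroup V] [Module ℝ V]
    [FiniteDimensional ℝ V] {S : Set (Gr k V)} (hS : IsAlgebraicSubset S) {X : Type*}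
    [TopologicalSpace X] (T : X → V ≃ₗ[ℝ] V)
    (hT : ∀ (l : Module.Dual ℝ V) (v : V), Continuous fun x => l (T x v)) (W : Gr k V) :
    IsClosed {x | Gr.map (T x) W ∈ S} := by
  obtain ⟨P, -, hP⟩ := hS
  -- The frames of `T x W` are the images of the frames of `W`, so the equations can be indexed by
  -- frames that do not depend on `x`.
  have : {x | Gr.map (T x) W ∈ S} =
      ⋂ (v : Fin k → V) (_ : Submodule.span ℝ (range v) = W.1) (q ∈ P),
        {x | MvPolynomial.eval (fun l : Module.Dual ℝ (⋀[ℝ]^k V) =>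
          l (exteriorPower.ιMulti ℝ k fun i => T x (v i))) q = 0} := by
    ext x
    simp only [mem_ofPred_eq, mem_iInter, hP]
    constructor
    · intro h v hv q hq
      refine h (fun i => T x (v i)) ?_ q hq
      change Submodule.span ℝ (range (T x ∘ v)) = W.1.map (T x : V →ₗ[ℝ] V)
      rw [range_comp, ← hv, Submodule.map_span]
      rfl
    · intro h v hv q hq
      have := h (fun i => (T x).symm (v i)) ?_ q hq
      · simpa using this
      · change Submodule.span ℝ (range ((T x).symm ∘ v)) = W.1
        have h2 := congrArg (Submodule.map ((T x).symm : V →ₗ[ℝ] V)) hv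
        rw [Submodule.map_span] at h2
        rw [range_comp]
        refine h2.trans ?_
        change Submodule.map _ (Submodule.map _ W.1) = W.1
        rw [← Submodule.map_comp]
        simp
  rw [this]
  refine isClosed_iInter fun v => isClosed_iInter fun _ => isClosed_iInter fun q =>
    isClosed_iInter fun _ => isClosed_eq ?_ continuous_const
  have hl : ∀ l : Module.Dual ℝ (⋀[ℝ]^k V),
      Continuous fun x => l (exteriorPower.ιMulti ℝ k fun i => T x (v i)) := fun l =>
    continuous_multilinearMap_apply
      (l.compAlternatingMap (exteriorPower.ιMulti ℝ k)).toMultilinearMap fun l i => hT l (v i)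
  simp only [MvPolynomial.eval_eq]
  refine continuous_finsetSum _ fun n _ => continuous_const.mul
    (continuous_finsetProd _ fun l _ => (hl l).pow _)

variable [AddCommGroup V] [Module ℝ V]

theorem Gr.map_map {V' V'' : Type*} [AddCommGroup V'] [Module ℝ V'] [AddCommGroup V'']
    [Module ℝ V''] (e : V ≃ₗ[ℝ] V') (e' : V' ≃ₗ[ℝ] V'') (W : Gr k V) :
    Gr.map e' (Gr.map e W) = Gr.map (e.trans e') W :=
  Subtype.ext (Submodule.map_comp (e : V →ₗ[ℝ] V') (e' : V' →ₗ[ℝ] V'') W.1).symm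

theorem Gr.map_injective {V' : Type*} [AddCommGroup V'] [Module ℝ V'] (e : V ≃ₗ[ℝ] V') :
    Function.Injective (Gr.map (k := k) e) := fun _ _ h =>
  Subtype.ext (Submodule.map_injective_of_injective e.injective (congrArg Subtype.val h))

/-- A transvection carries a plane `W` to a plane whose intersection with `W'` is larger. -/
theorem exists_transvection_finrank_inf_lt [FiniteDimensional ℝ V] {W W' : Gr k V} (h : W ≠ W') :
    ∃ (u : V) (f : Module.Dual ℝ V) (hf : f u = 0),
      Module.finrank ℝ (W.1 ⊓ W'.1 : Submodule ℝ V) <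
        Module.finrank ℝ ((Gr.map (LinearEquiv.transvection hf) W).1 ⊓ W'.1 : Submodule ℝ V) := by
  have h1 : ¬ W.1 ≤ W'.1 := fun hle =>
    h (Subtype.ext (Submodule.eq_of_le_of_finrank_eq hle (W.2.trans W'.2.symm)))
  have h2 : ¬ W'.1 ≤ W.1 := fun hle =>
    h (Subtype.ext (Submodule.eq_of_le_of_finrank_eq hle (W'.2.trans W.2.symm)).symm)
  obtain ⟨w, hw, hw'⟩ := SetLike.not_le_iff_exists.1 h1
  obtain ⟨w', hw'2, hw'1⟩ := SetLike.not_le_iff_exists.1 h2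
  set I : Submodule ℝ V := W.1 ⊓ W'.1 with hI
  -- The functional `f` must vanish on `I`, so that the old intersection stays fixed, and on `w' -
  -- w`, so that `f u = 0`. The scaling of `u` below makes the transvection send `w` to `w'`.
  set N : Submodule ℝ V := I ⊔ Submodule.span ℝ {w' - w} with hN
  have hwN : w ∉ N := by
    intro hwN
    obtain ⟨x, hx, y, hy, hxy⟩ := Submodule.mem_sup.1 hwN
    obtain ⟨c, rfl⟩ := Submodule.mem_span_singleton.1 hy
    rcases eq_or_ne c 0 with rfl | hc
    · rw [zero_smul, add_zero] at hxy
      exact hw' (hxy ▸ hx.2)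
    · refine hw'1 ?_
      have : c • w' = w - x + c • w := by
        rw [← sub_eq_iff_eq_add, ← smul_sub, ← hxy, add_sub_cancel_left, hxy]
      have hm : c • w' ∈ W.1 := by
        rw [this]
        exact W.1.add_mem (W.1.sub_mem hw hx.1) (W.1.smul_mem _ hw)
      exact (W.1.smul_mem_iff hc).1 hm
  obtain ⟨f, hfw, hfN⟩ := Submodule.exists_dual_map_eq_bot_of_notMem hwN inferInstance
  have hker : ∀ x ∈ N, f x = 0 := fun x hx => by
    have : f x ∈ N.map f := Submodule.mem_map_of_mem hx
    rwa [hfN, Submodule.mem_bot] at this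
  have hu : f (w' - w) = 0 :=
    hker _ (Submodule.mem_sup_right (Submodule.mem_span_singleton_self _))
  set u : V := (f w)⁻¹ • (w' - w) with hu_def
  have hfu : f u = 0 := by rw [hu_def, map_smul, hu, smul_zero]
  refine ⟨u, f, hfu, Submodule.finrank_lt_finrank_of_lt (lt_of_le_of_ne ?_ ?_)⟩
  · intro x hx
    refine ⟨⟨x, hx.1, ?_⟩, hx.2⟩
    change x + f x • u = x
    rw [hker x (Submodule.mem_sup_left hx), zero_smul, add_zero]
  · intro he
    have : w' ∈ (Gr.map (LinearEquiv.transvection hfu) W).1 ⊓ W'.1 := by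
      refine ⟨⟨w, hw, ?_⟩, hw'2⟩
      change w + f w • u = w'
      rw [hu_def, smul_smul, mul_inv_cancel₀ hfw, one_smul]
      abel
    rw [← he] at this
    exact hw'1 this.1

/-- A set of planes that is invariant under all transvections is empty or everything. -/
theorem eq_empty_or_univ_of_transvection [FiniteDimensional ℝ V] {S : Set (Gr k V)}
    (hS : ∀ (u : V) (f : Module.Dual ℝ V) (hf : f u = 0), ∀ W ∈ S,
      Gr.map (LinearEquiv.transvection hf) W ∈ S) : S = ∅ ∨ S = univ := by
  rcases S.eq_empty_or_nonempty with h | ⟨W, hW⟩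
  · exact Or.inl h
  refine Or.inr (eq_univ_of_forall fun W' => ?_)
  -- Induction on the codimension of `W ⊓ W'` in `W'`; each transvection lowers it until the planes
  -- coincide.
  have : ∀ n : ℕ, ∀ W ∈ S, k - Module.finrank ℝ (W.1 ⊓ W'.1 : Submodule ℝ V) ≤ n → W' ∈ S := by
    intro n
    induction n with
    | zero =>
      intro W hW hn
      by_contra hc
      obtain ⟨u, f, hf, hlt⟩ := exists_transvection_finrank_inf_lt
        (show W ≠ W' from fun he => hc (he ▸ hW))
      have := Submodule.finrank_mono
        (inf_le_right : (Gr.map (LinearEquiv.transvection hf) W).1 ⊓ W'.1 ≤ W'.1)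
      rw [W'.2] at this
      omega
    | succ n ih =>
      intro W hW hn
      by_contra hc
      obtain ⟨u, f, hf, hlt⟩ := exists_transvection_finrank_inf_lt
        (show W ≠ W' from fun he => hc (he ▸ hW))
      exact hc (ih _ (hS u f hf W hW) (by omega))
  exact this _ W hW le_rfl

end Grassmannian

/-! ### Rigidity of algebraic sets of planes under the affine perturbations -/

section Rigidity

variable {d k : ℕ}

/-- The entries of a matrix other than the upper left one. -/
abbrev Entries (d : ℕ) : Type := {p : Fin d × Fin d // ¬ (p.1.val = 0 ∧ p.2.val = 0)} → ℝ

theorem expLinear_neg_mul (m : Entries d) : expLinear (-m) * expLinear m = 1 := by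
  have h : linearPart ((0, -m) : Param d) = - linearPart ((0, m) : Param d) := by
    ext i j
    by_cases h : i.val = 0 ∧ j.val = 0 <;> simp [linearPart, h]
  rw [expLinear, h, Matrix.exp_neg]
  exact Matrix.nonsing_inv_mul _ ((Matrix.isUnit_iff_isUnit_det _).1 (isUnit_expLinear m))

/-- The action of `exp A'` on `ℝ^d`. -/
def expEquiv (m : Entries d) : EuclideanSpace ℝ (Fin d) ≃ₗ[ℝ] EuclideanSpace ℝ (Fin d) where
  toFun y := WithLp.toLp 2 ((expLinear m).mulVec y.ofLp)
  invFun y := WithLp.toLp 2 ((expLinear (-m)).mulVec y.ofLp)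
  map_add' x y := by simp [Matrix.mulVec_add]
  map_smul' c x := by simp [Matrix.mulVec_smul]
  left_inv y := by simp [expLinear_neg_mul]
  right_inv y := by
    have := expLinear_neg_mul (-m)
    rw [neg_neg] at this
    simp [this]

theorem expEquiv_symm_apply (m : Entries d) (y : EuclideanSpace ℝ (Fin d)) :
    (expEquiv m).symm y = expEquiv (-m) y := rfl

theorem expEquiv_zero : expEquiv (0 : Entries d) = LinearEquiv.refl ℝ _ := by
  ext1 y
  simp [expEquiv, expLinear_zero]

theorem continuous_expEquiv {X : Type*} [TopologicalSpace X] {m : X → Entries d}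
    {y : X → EuclideanSpace ℝ (Fin d)} (hm : Continuous m) (hy : Continuous y) :
    Continuous fun x => expEquiv (m x) (y x) := by
  have := (continuous_expLinear (d := d)).comp hm
  change Continuous fun x => WithLp.toLp 2 ((expLinear (m x)).mulVec (y x).ofLp)
  exact (PiLp.continuous_toLp 2 _).comp
    (this.matrix_mulVec ((PiLp.continuous_ofLp 2 _).comp hy))

/-! ### Transvections as exponentials of trace-free matrices. -/

theorem exp_eq_one_add_of_mul_self {n : Type*} [Fintype n] [DecidableEq n] {X : Matrix n n ℝ}
    (hX : X * X = 0) : NormedSpace.exp X = 1 + X := by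
  refine (hasSum_matrix_exp X).unique ?_
  have h : ∀ j ∉ Finset.range 2, ((j.factorial : ℝ)⁻¹) • X ^ j = 0 := by
    intro j hj
    obtain ⟨i, rfl⟩ := Nat.exists_eq_add_of_le (not_lt.1 (fun h => hj (Finset.mem_range.2 h)))
    rw [pow_add, pow_two, hX, zero_mul, smul_zero]
  simpa [Finset.sum_range_succ] using hasSum_sum_of_ne_finset_zero h

/-- Every one parameter group of transvections is conjugate to some `exp (t A')`. -/
theorem exists_expEquiv_eq_transvection {V : Type*} [AddCommGroup V] [Module ℝ V]
    (L : V ≃ₗ[ℝ] EuclideanSpace ℝ (Fin d)) {u : V} {f : Module.Dual ℝ V} (hf : f u = 0) :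
    ∃ m : Entries d, ∀ (t : ℝ) (v : V), L.symm (expEquiv (t • m) (L v)) = v + (t * f v) • u := by
  let e : Fin d → V := fun j => L.symm (EuclideanSpace.single j 1)
  have hfe : ∀ v : V, ∑ j, f (e j) * L v j = f v := by
    intro v
    have : v = ∑ j, L v j • e j := by
      apply L.injective
      simp only [map_sum, map_smul, e, LinearEquiv.apply_symm_apply]
      ext i
      simp [Pi.single_apply]
    conv_rhs => rw [this]
    simp [mul_comm]
  -- The rank one matrix of $v\mapsto f(v)u$ in the coordinates `L`. Its square and its trace both
  -- vanish because `f u = 0`; trace zero is what lets its upper left entry be recovered from the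
  -- others.
  let N : Matrix (Fin d) (Fin d) ℝ := Matrix.of fun i j => L u i * f (e j)
  have hNN : N * N = 0 := by
    ext i j
    simp only [N, Matrix.mul_apply, Matrix.of_apply, Matrix.zero_apply]
    have : ∀ x, L u i * f (e x) * (L u x * f (e j)) = L u i * f (e j) * (f (e x) * L u x) :=
      fun x => by ring
    simp only [this, ← Finset.mul_sum, hfe, hf, mul_zero]
  have hlin : ∀ t : ℝ, linearPart ((0, t • fun p => N p.1.1 p.1.2) : Param d) = t • N := by
    intro t
    ext i j
    by_cases h : i.val = 0 ∧ j.val = 0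
    · have hij : i = j := Fin.ext (h.1.trans h.2.symm)
      subst hij
      have htr : ∑ l, N l l = 0 := by
        simp only [N, Matrix.of_apply]
        rw [← hf, ← hfe u]
        exact Finset.sum_congr rfl fun _ _ => mul_comm _ _
      have hs : ∑ l, N l l = N i i + ∑ l : {l : Fin d // l.val ≠ 0}, N l.1 l.1 := by
        rw [← Finset.sum_subtype (Finset.univ.erase i) (p := fun l : Fin d => l.val ≠ 0)
          (f := fun l => N l l) (fun x => by simp [Fin.ext_iff, h.1])]
        exact (Finset.add_sum_erase _ (fun l => N l l) (Finset.mem_univ i)).symm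
      simp only [linearPart, Matrix.of_apply, h.1, and_self, dif_pos, Pi.smul_apply,
        Matrix.smul_apply, smul_eq_mul, ← Finset.mul_sum]
      have : ∑ l : {l : Fin d // l.val ≠ 0}, N l.1 l.1 = - N i i := by linarith
      rw [this]
      ring
    · simp [linearPart, h]
  refine ⟨fun p => N p.1.1 p.1.2, fun t v => ?_⟩
  rw [LinearEquiv.symm_apply_eq]
  change WithLp.toLp 2 ((expLinear _).mulVec (L v).ofLp) = _
  rw [expLinear, hlin, exp_eq_one_add_of_mul_self (by simp [hNN])]
  ext i
  simp only [Matrix.add_mulVec, Matrix.one_mulVec, Matrix.smul_mulVec, map_add, map_smul]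
  simp only [Matrix.mulVec, dotProduct, N, Matrix.of_apply, Pi.add_apply, Pi.smul_apply,
    smul_eq_mul, PiLp.add_apply, PiLp.smul_apply]
  rw [← hfe v]
  simp only [mul_assoc, ← Finset.mul_sum]
  ring

/-- An algebraic set of planes that is invariant under a dense set of small elements of the form
`exp (-A'₀) exp A'` is trivial. -/
theorem IsAlgebraicSubset.eq_empty_or_univ {V : Type*} [AddCommGroup V] [Module ℝ V]
    [FiniteDimensional ℝ V] {S : Set (Gr k V)} (hS : IsAlgebraicSubset S)
    (L : V ≃ₗ[ℝ] EuclideanSpace ℝ (Fin d)) {U D : Set (Entries d)} (hU : U ∈ 𝓝 0)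
    (hUD : U ⊆ closure D)
    (h : ∀ m₀ ∈ D, ∀ m ∈ D, ∀ W ∈ S,
      Gr.map (((L.trans (expEquiv m)).trans (expEquiv m₀).symm).trans L.symm) W ∈ S) :
    S = ∅ ∨ S = univ := by
  have key : ∀ m ∈ U, ∀ W ∈ S, Gr.map ((L.trans (expEquiv m)).trans L.symm) W ∈ S := by
    intro m hm W hW
    have hcont : ∀ (l : Module.Dual ℝ V) (v : V), Continuous fun p : Entries d × Entries d =>
        l ((((L.trans (expEquiv p.2)).trans (expEquiv p.1).symm).trans L.symm) v) := by
      intro l v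
      simp only [LinearEquiv.trans_apply, expEquiv_symm_apply]
      exact (l ∘ₗ L.symm.toLinearMap).continuous_of_finiteDimensional.comp
        (continuous_expEquiv continuous_fst.neg
          (continuous_expEquiv continuous_snd continuous_const))
    have hc := hS.isClosed_setOf_map_mem
      (fun p : Entries d × Entries d =>
        ((L.trans (expEquiv p.2)).trans (expEquiv p.1).symm).trans L.symm) hcont W
    have hsub : D ×ˢ D ⊆ {p : Entries d × Entries d | Gr.map
        (((L.trans (expEquiv p.2)).trans (expEquiv p.1).symm).trans L.symm) W ∈ S} :=
      fun p hp => h p.1 hp.1 p.2 hp.2 W hW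
    have h2 := closure_minimal hsub hc
    rw [closure_prod_eq] at h2
    -- Taking the first parameter to be 0, a limit of `D`, removes the factor $e^{-A_0'}$.
    have h3 := @h2 (0, m) ⟨hUD (mem_of_mem_nhds hU), hUD hm⟩
    simpa [expEquiv_zero] using h3
  refine eq_empty_or_univ_of_transvection fun u f hf => ?_
  obtain ⟨m, hm⟩ := exists_expEquiv_eq_transvection L hf
  have hsmall : ∀ᶠ n : ℕ in Filter.atTop, ((n + 1 : ℝ)⁻¹) • m ∈ U := by
    have : Filter.Tendsto (fun n : ℕ => ((n + 1 : ℝ)⁻¹) • m) Filter.atTop (𝓝 0) := by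
      simpa using (tendsto_one_div_add_atTop_nhds_zero_nat (𝕜 := ℝ)).smul_const m
    exact this hU
  obtain ⟨n, hn⟩ := hsmall.exists
  set c : ℝ := (n + 1 : ℝ)⁻¹ with hc
  -- Since `f u = 0`, transvections along multiples of `u` compose additively; `n + 1` steps of size
  -- `c = 1 / (n + 1)` give the full transvection.
  have hiter : ∀ j : ℕ, ∀ W ∈ S, Gr.map (LinearEquiv.transvection
      (show f ((j * c : ℝ) • u) = 0 by rw [map_smul, hf, smul_zero])) W ∈ S := by
    intro j
    induction j with
    | zero =>
      intro W hW
      convert hW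
      refine Subtype.ext ?_
      have : ((LinearEquiv.transvection
        (show f (((0 : ℕ) * c : ℝ) • u) = 0 by rw [map_smul, hf, smul_zero]) : V ≃ₗ[ℝ] V) :
          V →ₗ[ℝ] V) = LinearMap.id := by
        ext v
        change v + f v • (((0 : ℕ) * c : ℝ) • u) = v
        simp
      simp only [Gr.map]
      rw [this, Submodule.map_id]
    | succ j ih =>
      intro W hW
      have h1 := key _ hn _ (ih W hW)
      rw [Gr.map_map] at h1
      convert h1 using 2
      ext v
      simp only [LinearEquiv.trans_apply, hm]
      change v + f v • (((j + 1 : ℕ) * c : ℝ) • u) =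
        (v + f v • ((j * c : ℝ) • u)) + (c * f (v + f v • ((j * c : ℝ) • u))) • u
      simp only [map_add, map_smul, hf, smul_zero, add_zero, smul_smul, add_assoc, ← add_smul]
      push_cast
      congr 2
      ring
  intro W hW
  have := hiter (n + 1) W hW
  convert this using 3
  rw [hc]
  push_cast
  rw [mul_inv_cancel₀ (by positivity), one_smul]

theorem closedCube_mem_nhds {ε : ℝ} (hε : 0 < ε) : closedCube d ε ∈ 𝓝 (0 : Param d) := by
  have h1 : ∀ᶠ a in 𝓝 (0 : Param d), ∀ i, |a.1 i| ≤ ε := by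
    refine Filter.eventually_all.2 fun i => ?_
    have : Continuous fun a : Param d => |a.1 i| := by fun_prop
    exact (this.tendsto 0).eventually (ge_mem_nhds (by simpa using hε))
  have h2 : ∀ᶠ a in 𝓝 (0 : Param d), ∀ p, |a.2 p| ≤ ε := by
    refine Filter.eventually_all.2 fun i => ?_
    have : Continuous fun a : Param d => |a.2 i| := by fun_prop
    exact (this.tendsto 0).eventually (ge_mem_nhds (by simpa using hε))
  exact h1.and h2

/-- A property of the end point and the linear part of almost every small affine map holds, for a
suitable end point, for a dense set of small linear parts. -/
theorem exists_endpoint {ε : ℝ} (hε : 0 < ε) (y : EuclideanSpace ℝ (Fin d))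
    {P : EuclideanSpace ℝ (Fin d) → Entries d → Prop}
    (h : ∀ᵐ a ∂(volume : Measure (Param d)).restrict (closedCube d ε), P (affineMap a y) a.2) :
    ∃ w, ∃ U ∈ 𝓝 (0 : Entries d), ∃ D, U ⊆ closure D ∧ ∀ m ∈ D, P w m := by
  -- Parametrizes affine maps by the image `q.1` of `y` and the linear part, instead of by the
  -- translation. For each linear part it is a translation, hence measure preserving.
  let τ : (Fin d → ℝ) × Entries d → Param d := fun q => (q.1 - (expLinear q.2).mulVec y.ofLp, q.2)
  have hτc : Continuous τ := by
    have := continuous_expLinear (d := d)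
    fun_prop
  have hτ : MeasurePreserving τ volume volume := by
    have h1 : MeasurePreserving
        (fun q : Entries d × (Fin d → ℝ) => (q.1, q.2 - (expLinear q.1).mulVec y.ofLp))
        (volume.prod volume) (volume.prod volume) := by
      refine (MeasurePreserving.id (volume : Measure (Entries d))).skew_product
        (g := fun m (c : Fin d → ℝ) => c - (expLinear m).mulVec y.ofLp) ?_ ?_
      · have := continuous_expLinear (d := d)
        refine Continuous.measurable ?_
        unfold Function.uncurry
        fun_prop
      · exact Filter.Eventually.of_forall fun m => (measurePreserving_sub_right volume _).map_eq
    exact (Measure.measurePreserving_swap.comp h1).comp Measure.measurePreserving_swap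
  have hmeas : MeasurableSet (closedCube d ε) := by
    have : closedCube d ε = (⋂ i, {a : Param d | |a.1 i| ≤ ε}) ∩ ⋂ p, {a | |a.2 p| ≤ ε} := by
      ext a
      simp [closedCube]
    rw [this]
    refine IsClosed.measurableSet (IsClosed.inter (isClosed_iInter fun i => ?_)
      (isClosed_iInter fun i => ?_)) <;>
    exact isClosed_le (by fun_prop) continuous_const
  rw [ae_restrict_iff' hmeas] at h
  have h' := Measure.ae_ae_of_ae_prod (hτ.quasiMeasurePreserving.ae h)
  have h0 : τ ⁻¹' closedCube d ε ∈ 𝓝 (y.ofLp, (0 : Entries d)) := by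
    refine hτc.continuousAt.preimage_mem_nhds ?_
    have : τ (y.ofLp, 0) = 0 := by simp [τ, expLinear_zero]
    rw [this]
    exact closedCube_mem_nhds hε
  obtain ⟨O, U, hO, hyO, hU, h0U, hOU⟩ := mem_nhds_prod_iff'.1 h0
  -- Points good for almost every linear part are dense, so one lies in the open set `O` of end
  -- points whose parameters stay in the cube for all linear parts in `U`.
  obtain ⟨c, hcO, hc⟩ := (Measure.dense_of_ae h').inter_open_nonempty O hO ⟨_, hyO⟩
  refine ⟨WithLp.toLp 2 c, U, hU.mem_nhds h0U, _,
    (Measure.dense_of_ae hc).open_subset_closure_inter hU, ?_⟩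
  rintro m ⟨hmU, hm⟩
  have := hm (@hOU (c, m) ⟨hcO, hmU⟩)
  simpa [τ, affineMap] using this

/-! ### Planes described by frames. -/

theorem Gr.exists_frame {V : Type*} [AddCommGroup V] [Module ℝ V] [FiniteDimensional ℝ V]
    (W : Gr k V) :
    ∃ u : Fin k → V, LinearIndependent ℝ u ∧ Submodule.span ℝ (range u) = W.1 := by
  let b := Module.finBasisOfFinrankEq ℝ W.1 W.2
  refine ⟨fun i => b i, b.linearIndependent.map' W.1.subtype (Submodule.ker_subtype _), ?_⟩
  have := congrArg (Submodule.map W.1.subtype) b.span_eq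
  rw [Submodule.map_span, ← range_comp, Submodule.map_top, Submodule.range_subtype] at this
  exact this

/-- The plane spanned by a frame. -/
def spanGr {V : Type*} [AddCommGroup V] [Module ℝ V] {u : Fin k → V}
    (hu : LinearIndependent ℝ u) : Gr k V :=
  ⟨Submodule.span ℝ (range u), by rw [finrank_span_eq_card hu, Fintype.card_fin]⟩

theorem map_spanGr {V V' : Type*} [AddCommGroup V] [Module ℝ V] [AddCommGroup V'] [Module ℝ V']
    (e : V ≃ₗ[ℝ] V') {u : Fin k → V} (hu : LinearIndependent ℝ u) :
    Gr.map e (spanGr hu) = spanGr (u := fun i => e (u i)) (hu.map' e.toLinearMap e.ker) := by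
  refine Subtype.ext ?_
  change Submodule.map _ (Submodule.span ℝ (range u)) = _
  rw [Submodule.map_span, ← range_comp]
  rfl

/-- An algebraic set of planes at `y` that is carried by almost every small affine map to a set
that depends only on the end point is trivial. -/
theorem IsAlgebraicSubset.eq_empty_or_univ_of_ae {V : Type*} [AddCommGroup V]
    [Module ℝ V] [FiniteDimensional ℝ V] {S : Set (Gr k V)} (hS : IsAlgebraicSubset S)
    (L : V ≃ₗ[ℝ] EuclideanSpace ℝ (Fin d)) {ε : ℝ} (hε : 0 < ε) (y : EuclideanSpace ℝ (Fin d))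
    {F : Set (EuclideanSpace ℝ (Fin d) × (Fin k → EuclideanSpace ℝ (Fin d)))}
    (hF : ∀ (u : Fin k → V) (hu : LinearIndependent ℝ u),
      spanGr hu ∈ S ↔ (y, fun i => L (u i)) ∈ F)
    (h : ∀ᵐ a ∂(volume : Measure (Param d)).restrict (closedCube d ε),
      ∀ v : Fin k → EuclideanSpace ℝ (Fin d), LinearIndependent ℝ v →
        ((y, v) ∈ F ↔ (affineMap a y, fun i => expEquiv a.2 (v i)) ∈ F)) :
    S = ∅ ∨ S = univ := by
  obtain ⟨w, U, hU, D, hUD, hD⟩ := exists_endpoint hε y (P := fun w m =>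
    ∀ v : Fin k → EuclideanSpace ℝ (Fin d), LinearIndependent ℝ v →
        ((y, v) ∈ F ↔ (w, fun i => expEquiv m (v i)) ∈ F)) h
  refine hS.eq_empty_or_univ L hU hUD fun m₀ hm₀ m hm W hW => ?_
  obtain ⟨u, hu, huW⟩ := W.exists_frame
  obtain rfl : W = spanGr hu := Subtype.ext huW.symm
  rw [map_spanGr, hF]
  rw [hF] at hW
  have hLu : LinearIndependent ℝ fun i => L (u i) := hu.map' L.toLinearMap L.ker
  rw [hD m hm _ hLu] at hW
  simp only [LinearEquiv.trans_apply, LinearEquiv.apply_symm_apply]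
  -- Both linear parts lead to the same end point `w`, so membership at `w` is compared through `m`
  -- and then back through `m₀`.
  rw [hD m₀ hm₀]
  · simpa using hW
  · exact hLu.map' (((expEquiv m).trans (expEquiv m₀).symm).toLinearMap) (LinearEquiv.ker _)

end Rigidity

/-! ### Frames in charts -/

section Frames

variable {d k : ℕ} {M : Type*} [TopologicalSpace M]
  [ChartedSpace (EuclideanSpace ℝ (Fin d)) M]

instance (x : M) : FiniteDimensional ℝ (TangentSpace (𝓡 d) x) :=
  inferInstanceAs (FiniteDimensional ℝ (EuclideanSpace ℝ (Fin d)))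

/-- The vectors `u` form a frame of a plane at `x` that belongs to `E`. -/
def FrameIn (E : Set (GrBundle (d := d) k M)) (x : M) (u : Fin k → EuclideanSpace ℝ (Fin d)) :
    Prop :=
  ∃ hu : LinearIndependent ℝ (fun i => (u i : TangentSpace (𝓡 d) x)), spanGr hu ∈ fiber E x

theorem frameIn_congr_fiber {E B : Set (GrBundle (d := d) k M)} {x : M}
    (h : fiber E x = fiber B x) (u : Fin k → EuclideanSpace ℝ (Fin d)) :
    FrameIn E x u ↔ FrameIn B x u := by
  rw [FrameIn, FrameIn, h]

/-- The derivative is an isomorphism, so it acts injectively on planes and the image equality can be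
read in both directions. -/
theorem frameIn_iff_of_fiber_eq {E : Set (GrBundle (d := d) k M)} (f : M ≃ₘ⟮𝓡 d, 𝓡 d⟯ M) {x : M}
    (h : fiber E (f x) = grDeriv f x '' fiber E x) (u : Fin k → EuclideanSpace ℝ (Fin d)) :
    FrameIn E x u ↔ FrameIn E (f x) fun i => mfderiv (𝓡 d) (𝓡 d) f x (u i) := by
  let e := (f.mfderivToContinuousLinearEquiv (by simp : (∞ : ℕ∞ω) ≠ 0) x).toLinearEquiv
  constructor
  · rintro ⟨hu, hm⟩
    refine ⟨hu.map' e.toLinearMap e.ker, ?_⟩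
    rw [h]
    exact ⟨_, hm, map_spanGr e hu⟩
  · rintro ⟨hu, hm⟩
    have hu' : LinearIndependent ℝ (fun i => (u i : TangentSpace (𝓡 d) x)) :=
      LinearIndependent.of_comp e.toLinearMap hu
    refine ⟨hu', ?_⟩
    rw [h] at hm
    obtain ⟨W, hW, hWe⟩ := hm
    have : grDeriv f x W = grDeriv f x (spanGr hu') := hWe.trans (map_spanGr e hu').symm
    exact (congrArg (· ∈ fiber E x) (Gr.map_injective _ this)).mp hW

/-- The frames, in the coordinates of a chart, of the planes that belong to `B`. -/
def chartFrames (e : OpenPartialHomeomorph M (EuclideanSpace ℝ (Fin d)))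
    (B : Set (GrBundle (d := d) k M)) :
    Set (EuclideanSpace ℝ (Fin d) × (Fin k → EuclideanSpace ℝ (Fin d))) :=
  {q | q.1 ∈ e.target ∧ LinearIndependent ℝ q.2 ∧
    FrameIn B (e.symm q.1) fun i => mfderiv (𝓡 d) (𝓡 d) e.symm q.1 (q.2 i)}

theorem mdifferentiable_of_mem_maximalAtlas
    {e : OpenPartialHomeomorph M (EuclideanSpace ℝ (Fin d))}
    (he : e ∈ IsManifold.maximalAtlas (𝓡 d) ∞ M) : e.MDifferentiable (𝓡 d) (𝓡 d) :=
  ⟨(contMDiffOn_of_mem_maximalAtlas he).mdifferentiableOn (by simp),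
    (contMDiffOn_symm_of_mem_maximalAtlas he).mdifferentiableOn (by simp)⟩

/-- Over the open set of independent frames, the derivative of the inverse chart is a continuous map
to the frame bundle, and thus to the Grassmannian bundle; the set is a preimage of `B` under it. -/
theorem measurableSet_chartFrames [IsManifold (𝓡 d) ∞ M]
    {e : OpenPartialHomeomorph M (EuclideanSpace ℝ (Fin d))}
    (he : e ∈ IsManifold.maximalAtlas (𝓡 d) ∞ M) {B : Set (GrBundle (d := d) k M)}
    (hB : MeasurableSet B) : MeasurableSet (chartFrames e B) := by
  have hd := mdifferentiable_of_mem_maximalAtlas he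
  let O : Set (EuclideanSpace ℝ (Fin d) × (Fin k → EuclideanSpace ℝ (Fin d))) :=
    e.target ×ˢ {v | LinearIndependent ℝ v}
  have hO : IsOpen O := e.open_target.prod isOpen_setOfPred_linearIndependent
  have hli : ∀ q : O, LinearIndependent ℝ fun i =>
      (mfderiv (𝓡 d) (𝓡 d) e.symm q.1.1 (q.1.2 i) : TangentSpace (𝓡 d) (e.symm q.1.1)) := by
    intro q
    exact q.2.2.map' (hd.symm.mfderiv q.2.1).toLinearEquiv.toLinearMap (LinearEquiv.ker _)
  let g : O → FrameBundle (d := d) k M := fun q => ⟨e.symm q.1.1, _, hli q⟩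
  have hg : Continuous g := by
    refine continuous_induced_rng.2 (Continuous.prodMk ?_ (continuous_pi fun i => ?_))
    · exact e.continuousOn_symm.comp_continuous (by fun_prop) fun q => q.2.1
    · have h1 := (contMDiffOn_symm_of_mem_maximalAtlas he).continuousOn_tangentMapWithin
        (by simp) e.open_target.uniqueMDiffOn
      have h2 : Continuous fun q : O =>
          (⟨q.1.1, q.1.2 i⟩ : TangentBundle (𝓡 d) (EuclideanSpace ℝ (Fin d))) :=
        (tangentBundleModelSpaceHomeomorph (𝓡 d)).symm.continuous.comp
          (f := fun q : O => ((q.1.1, q.1.2 i) :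
            ModelProd (EuclideanSpace ℝ (Fin d)) (EuclideanSpace ℝ (Fin d))))
          ((continuous_fst.comp continuous_subtype_val).prodMk
            ((continuous_apply i).comp (continuous_snd.comp continuous_subtype_val)))
      refine (h1.comp_continuous h2 fun q => q.2.1).congr fun q => ?_
      exact congrArg (fun T : TangentSpace (𝓡 d) q.1.1 →L[ℝ] TangentSpace (𝓡 d) (e.symm q.1.1) =>
        (⟨e.symm q.1.1, T (q.1.2 i)⟩ : TangentBundle (𝓡 d) M))
        (mfderivWithin_of_isOpen e.open_target q.2.1)
  have hG : Continuous (FrameBundle.toGr : FrameBundle (d := d) k M → GrBundle (d := d) k M) :=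
    continuous_coinduced_rng
  have hm : Measurable fun q : O => (g q).toGr := (hG.comp hg).measurable
  have : chartFrames e B = Subtype.val '' ((fun q : O => (g q).toGr) ⁻¹' B) := by
    ext q
    constructor
    · rintro ⟨h1, h2, h3, h4⟩
      exact ⟨⟨q, h1, h2⟩, h4, rfl⟩
    · rintro ⟨q, hq, rfl⟩
      exact ⟨q.2.1, q.2.2, hli q, hq⟩
  rw [this]
  exact (MeasurableEmbedding.subtype_coe hO.measurableSet).measurableSet_image.2 (hm hB)

/-- The derivative of the affine map. -/
def expCLM (m : Entries d) : EuclideanSpace ℝ (Fin d) →L[ℝ] EuclideanSpace ℝ (Fin d) :=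
  LinearMap.toContinuousLinearMap (expEquiv m).toLinearMap

theorem hasFDerivAt_affineMap (a : Param d) (y : EuclideanSpace ℝ (Fin d)) :
    HasFDerivAt (affineMap a) (expCLM a.2) y :=
  (expCLM a.2).hasFDerivAt.add_const (WithLp.toLp 2 a.1)

/-- The derivative of a map that is affine in a chart. -/
theorem mfderiv_comp_symm_of_affine {e : OpenPartialHomeomorph M (EuclideanSpace ℝ (Fin d))}
    (he : e ∈ IsManifold.maximalAtlas (𝓡 d) ∞ M) (g : M ≃ₘ⟮𝓡 d, 𝓡 d⟯ M) (a : Param d)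
    {y : EuclideanSpace ℝ (Fin d)} (hy : y ∈ e.target) (hay : affineMap a y ∈ e.target)
    (h : ∀ᶠ y' in 𝓝 y, g (e.symm y') = e.symm (affineMap a y'))
    (v : EuclideanSpace ℝ (Fin d)) :
    (mfderiv (𝓡 d) (𝓡 d) g (e.symm y) (mfderiv (𝓡 d) (𝓡 d) e.symm y v) :
      EuclideanSpace ℝ (Fin d)) =
      mfderiv (𝓡 d) (𝓡 d) e.symm (affineMap a y) (expEquiv a.2 v) := by
  have hd := mdifferentiable_of_mem_maximalAtlas he
  have h1 := mfderiv_comp_apply y (g.mdifferentiable (by simp) (e.symm y))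
    (hd.mdifferentiableAt_symm hy) v
  have ha : HasMFDerivAt (𝓡 d) (𝓡 d) (affineMap a) y
    (expCLM a.2) :=
      (hasFDerivAt_affineMap a y).hasMFDerivAt
  have h2 := mfderiv_comp_apply y (hd.mdifferentiableAt_symm hay) ha.mdifferentiableAt v
  have h3 : (g ∘ e.symm) =ᶠ[𝓝 y] (e.symm ∘ affineMap a) := h
  refine h1.symm.trans (Eq.trans ?_ (h2.trans ?_))
  · rw [h3.mfderiv_eq]; rfl
  · rw [ha.mfderiv]
    rfl

end Frames

/-! ### The law of the random walk -/

/-- Exchange of quantifiers for the projection of a Borel set. -/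
theorem ae_ae_swap_of_forall_notMem {X Y Z Ω : Type*} [TopologicalSpace X] [PolishSpace X]
    [MeasurableSpace X] [BorelSpace X] [TopologicalSpace Y] [PolishSpace Y]
    [MeasurableSpace Y] [BorelSpace Y] [TopologicalSpace Z] [PolishSpace Z]
    [MeasurableSpace Z] [BorelSpace Z] [MeasurableSpace Ω] {μ : Measure X} [IsFiniteMeasure μ]
    {ν : Measure Ω} [IsFiniteMeasure ν] {h : Ω → Y} (hh : Measurable h)
    {s : Set ((X × Y) × Z)} (hs : MeasurableSet s)
    (H : ∀ᵐ a ∂μ, ∀ᵐ x ∂ν, ∀ z, ((a, h x), z) ∉ s) :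
    ∀ᵐ x ∂ν, ∀ᵐ a ∂μ, ∀ z, ((a, h x), z) ∉ s := by
  have hm : Measurable (Prod.map id h : X × Ω → X × Y) := measurable_id.prodMap hh
  -- The projection is taken over the Polish space `X × Y` with the pushforward measure and then
  -- pulled back, since `Ω` is only a measurable space.
  have hN : NullMeasurableSet {p : X × Ω | ∃ z, ((p.1, h p.2), z) ∈ s} (μ.prod ν) :=
    (nullMeasurableSet_setOf_exists ((μ.prod ν).map (Prod.map id h)) hs).preimage
      (hm.quasiMeasurePreserving _)
  obtain ⟨t, -, ht, hst⟩ := hN.exists_measurable_superset_ae_eq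
  have h1 := Measure.ae_ae_of_ae_prod hst
  have h2 : (μ.prod ν) t = 0 := by
    refine (Measure.measure_prod_null ht).2 ?_
    filter_upwards [H, h1] with a ha ha'
    refine measure_mono_null (t := {x | ¬ (∀ z, ((a, h x), z) ∉ s)} ∪
      {x | ¬ (t (a, x) = ({p : X × Ω | ∃ z, ((p.1, h p.2), z) ∈ s} : Set (X × Ω)) (a, x))}) ?_
      (measure_union_null ha ha')
    intro x hx
    by_contra hc
    simp only [mem_union, mem_ofPred_eq, not_or, not_not] at hc
    have hx' : t (a, x) := hx
    rw [hc.2] at hx'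
    obtain ⟨z, hz⟩ := hx'
    exact hc.1 z hz
  have h3 : ∀ᵐ p ∂(μ.prod ν), ∀ z, ((p.1, h p.2), z) ∉ s := by
    refine measure_mono_null (t := t ∪ {p | ¬ (t p =
      ({p : X × Ω | ∃ z, ((p.1, h p.2), z) ∈ s} : Set (X × Ω)) p)}) ?_
      (measure_union_null h2 hst)
    intro p hp
    by_contra hc
    simp only [mem_union, mem_ofPred_eq, not_or, not_not] at hc
    refine hc.1 ?_
    change t p
    rw [hc.2]
    have hp' : ¬ ∀ z, ((p.1, h p.2), z) ∉ s := hp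
    push Not at hp'
    exact hp'
  exact Measure.ae_ae_of_ae_prod
    (Measure.measurePreserving_swap.quasiMeasurePreserving.ae h3)

theorem isCompact_closedCube (d : ℕ) (ε : ℝ) : IsCompact (closedCube d ε) := by
  have : closedCube d ε =
      (Set.pi univ fun _ => Icc (-ε) ε) ×ˢ (Set.pi univ fun _ => Icc (-ε) ε) := by
    ext a
    simp only [closedCube, abs_le, mem_ofPred_eq, mem_prod, mem_pi, mem_univ, true_imp_iff, mem_Icc]
  rw [this]
  exact (isCompact_univ_pi fun _ => isCompact_Icc).prod (isCompact_univ_pi fun _ => isCompact_Icc)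

theorem closedCube_subset_openCube {d : ℕ} {ε δ : ℝ} (h : ε < δ) :
    closedCube d ε ⊆ openCube d δ :=
  fun _ ha => ⟨fun i => (ha.1 i).trans_lt h, fun p => (ha.2 p).trans_lt h⟩

section Law

variable {d k n : ℕ} {M : Type*} [TopologicalSpace M]
  [ChartedSpace (EuclideanSpace ℝ (Fin d)) M] [IsManifold (𝓡 d) ∞ M] [MeasurableSpace M]
  {G : Metric (d := d) M}

theorem measurable_volDiffeo {X : Type*} [MeasurableSpace X] {h : X → VolDiffeo G}
    (hh : ∀ x : M, Measurable fun a => h a x) : Measurable h := by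
  rw [measurable_iff_comap_le]
  change MeasurableSpace.comap h (⨆ x : M, _) ≤ _
  rw [MeasurableSpace.comap_iSup]
  refine iSup_le fun x => ?_
  rw [MeasurableSpace.comap_comp]
  exact (hh x).comap_le

theorem measurable_eval_volDiffeo (x : M) : Measurable fun f : VolDiffeo G => f x := by
  rw [measurable_iff_comap_le]
  exact le_iSup (fun x : M => MeasurableSpace.comap (fun f : VolDiffeo G => f x) inferInstance) x

theorem VolDiffeo.continuous (f : VolDiffeo G) : Continuous f := f.1.continuous

/-- Inside the chart, the flow is smooth in the parameter and stays in the ball, where the inverse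
chart is continuous; elsewhere the map is the identity. -/
theorem Perturbations.continuous_eval [BorelSpace M] (D : Perturbations G n) {ε : ℝ}
    (hεδ : ε < D.δ) (i : Fin n) (z : M) :
    Continuous fun a : closedCube d ε => D.g i a z := by
  have hsub := closedCube_subset_openCube (d := d) hεδ
  by_cases hz : z ∈ (D.φ i).chart.source
  · have h1 : ∀ a : closedCube d ε, D.g i a z =
        (D.φ i).chart.symm (D.flow.ψ a 1 ((D.φ i).chart z)) := fun a => D.g_eq i a (hsub a.2) z hz
    simp only [h1]
    have hy : (D.φ i).chart z ∈ Metric.ball 0 D.R := by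
      rw [← (D.φ i).target_eq]
      exact (D.φ i).chart.map_source hz
    refine (D.φ i).chart.continuousOn_symm.comp_continuous ?_ fun a => ?_
    · exact D.flow.ψ_smooth.continuousOn.comp_continuous
        (f := fun a : closedCube d ε => ((a : Param d), (1 : ℝ), (D.φ i).chart z)) (by fun_prop)
        fun a => ⟨hsub a.2, mem_univ _⟩
    · rw [(D.φ i).target_eq]
      exact D.flow.ψ_one_mem_ball (hsub a.2) hy
  · have h1 : ∀ a : closedCube d ε, D.g i a z = z := fun a => D.g_eq_id i a (hsub a.2) z hz
    simp only [h1]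
    exact continuous_const

theorem Perturbations.aemeasurable_comp [BorelSpace M] (D : Perturbations G n) {ε : ℝ}
    (hεδ : ε < D.δ) (f₀ : VolDiffeo G) (i : Fin n) :
    AEMeasurable (fun a => (D.g i a).comp f₀)
      ((volume : Measure (Param d)).restrict (closedCube d ε)) :=
  aemeasurable_restrict_of_measurable_subtype (isCompact_closedCube d ε).isClosed.measurableSet
    (measurable_volDiffeo fun x => (D.continuous_eval hεδ i (f₀ x)).measurable)

theorem preLaw_univ_ne_top (D : Perturbations G n) (f₀ : VolDiffeo G) (ε : ℝ) (p₀ : ℝ≥0)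
    (p : Fin n → ℝ≥0) : preLaw D f₀ ε p₀ p univ ≠ ⊤ := by
  have : IsFiniteMeasure ((volume : Measure (Param d)).restrict (closedCube d ε)) :=
    ⟨by simpa using (isCompact_closedCube d ε).measure_lt_top⟩
  have : IsFiniteMeasure (preLaw D f₀ ε p₀ p) := by
    unfold preLaw
    infer_instance
  exact measure_ne_top _ _

/-- Almost sure properties for the law of the random walk. -/
theorem ae_law_iff [BorelSpace M] {D : Perturbations G n} {f₀ : VolDiffeo G} {ε : ℝ}
    (hεδ : ε < D.δ) {p₀ : ℝ≥0} {p : Fin n → ℝ≥0} (hp₀ : 0 < p₀) (hp : ∀ i, 0 < p i)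
    {P : VolDiffeo G → Prop} (h : ∀ᵐ f ∂(law D f₀ ε p₀ p), P f) :
    P f₀ ∧ ∀ i, ∀ᵐ a ∂(volume : Measure (Param d)).restrict (closedCube d ε),
      P ((D.g i a).comp f₀) := by
  have h1 : preLaw D f₀ ε p₀ p {f | ¬ P f} = 0 := by
    have h' : law D f₀ ε p₀ p {f | ¬ P f} = 0 := h
    rw [law, Measure.smul_apply, smul_eq_mul, mul_eq_zero] at h'
    exact h'.resolve_left (ENNReal.inv_ne_zero.2 (preLaw_univ_ne_top D f₀ ε p₀ p))
  rw [preLaw, Measure.add_apply, add_eq_zero] at h1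
  constructor
  · have h2 := h1.1
    rw [Measure.smul_apply] at h2
    have h3 : Measure.dirac f₀ {f | ¬ P f} = 0 :=
      (smul_eq_zero.1 h2).resolve_left hp₀.ne'
    by_contra hc
    -- The exceptional set need not be measurable, so only the lower bound for the Dirac mass is
    -- available; it suffices.
    have := Measure.le_dirac_apply (s := {f | ¬ P f}) (a := f₀)
    rw [h3, indicator_of_mem (by exact hc)] at this
    simp at this
  · intro i
    have h2 := h1.2
    rw [Measure.finsetSum_apply, Finset.sum_eq_zero_iff] at h2
    have h3 := h2 i (Finset.mem_univ i)
    rw [Measure.smul_apply] at h3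
    have h4 := (smul_eq_zero.1 h3).resolve_left (hp i).ne'
    exact ae_of_ae_map (D.aemeasurable_comp hεδ f₀ i) h4

/-- A null set of a stationary measure is avoided by almost every step of the random walk. -/
theorem IsStationary.ae_ae [BorelSpace M] [CompactSpace M] [T2Space M]
    {μ : Measure (VolDiffeo G)} {ν : Measure M} [IsProbabilityMeasure ν] (hν : IsStationary μ ν)
    {P : M → Prop} (hP : ∀ᵐ x ∂ν, P x) : ∀ᵐ f ∂μ, ∀ᵐ x ∂ν, P (f x) := by
  have := Manifold.metrizableSpace (𝓡 d) M
  have := ChartedSpace.secondCountable_of_sigmaCompact (EuclideanSpace ℝ (Fin d)) M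
  -- Evaluation is continuous in the point and measurable in the diffeomorphism, hence jointly
  -- measurable; this makes the integrand in the stationarity equation measurable.
  have hu : Measurable (Function.uncurry fun (x : M) (f : VolDiffeo G) => f x) :=
    measurable_uncurry_of_continuous_of_measurable (fun f => f.continuous)
      measurable_eval_volDiffeo
  set N := toMeasurable ν {x | ¬ P x} with hN
  have hN0 : ν N = 0 := by rw [hN, measure_toMeasurable]; exact hP
  have hNm : MeasurableSet N := measurableSet_toMeasurable _ _
  have h := hν N hNm
  rw [hN0, lintegral_eq_zero_iff] at h
  · filter_upwards [h] with f hf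
    refine measure_mono_null (fun x hx => ?_) hf
    exact subset_toMeasurable ν {x | ¬ P x} hx
  · exact measurable_measure_prodMk_left (ν := ν) (hu.comp measurable_swap hNm)

end Law

/-! ### The main theorem -/

section Main

variable {d k n : ℕ} {M : Type*} [TopologicalSpace M]
  [ChartedSpace (EuclideanSpace ℝ (Fin d)) M] [IsManifold (𝓡 d) ∞ M] [MeasurableSpace M]
  {G : Metric (d := d) M}

/-- In a Moser chart, an invariant set of planes is carried along by the affine maps. -/
theorem Perturbations.chartFrames_iff (D : Perturbations G n) (f₀ : VolDiffeo G) (i : Fin n)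
    {a : Param d} (ha : a ∈ openCube d D.δ) {E B : Set (GrBundle (d := d) k M)} {x : M}
    (hx : f₀ x ∈ (D.φ i).inner)
    (h0 : fiber E (f₀ x) = grDeriv f₀.1 x '' fiber E x)
    (h1 : fiber E ((D.g i a).comp f₀ x) = grDeriv ((D.g i a).comp f₀).1 x '' fiber E x)
    (hB0 : fiber E (f₀ x) = fiber B (f₀ x))
    (hB1 : fiber E ((D.g i a).comp f₀ x) = fiber B ((D.g i a).comp f₀ x))
    {v : Fin k → EuclideanSpace ℝ (Fin d)} (hv : LinearIndependent ℝ v) :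
    ((D.φ i).chart (f₀ x), v) ∈ chartFrames (D.φ i).chart B ↔
      (affineMap a ((D.φ i).chart (f₀ x)), fun j => expEquiv a.2 (v j)) ∈
        chartFrames (D.φ i).chart B := by
  set e := (D.φ i).chart with he
  set z := f₀ x with hz
  set y := e z with hy
  have hzs : z ∈ e.source := hx.1
  have hyt : y ∈ e.target := e.map_source hzs
  have hyb : y ∈ Metric.ball 0 (1 / 2) := hx.2
  have hez : e.symm y = z := e.left_inv hzs
  have hloc : ∀ y' ∈ e.target, y' ∈ Metric.ball 0 (1 / 2) →
      D.g i a (e.symm y') = e.symm (affineMap a y') := by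
    intro y' h1 h2
    rw [D.g_eq i a ha _ (e.map_target h1), ← he, e.right_inv h1, D.flow.ψ_one_eq ha h2]
  have hay : affineMap a y ∈ e.target := by
    have hR := (D.φ i).target_eq
    rw [← he] at hR
    rw [hR, ← D.flow.ψ_one_eq ha hyb]
    exact D.flow.ψ_one_mem_ball ha (hR ▸ hyt)
  have hev : ∀ᶠ y' in 𝓝 y, (D.g i a).1 (e.symm y') = e.symm (affineMap a y') := by
    filter_upwards [e.open_target.mem_nhds hyt, Metric.isOpen_ball.mem_nhds hyb] using hloc
  have hder := mfderiv_comp_symm_of_affine (D.φ i).smooth (D.g i a).1 a hyt hay hev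
  have hgz : D.g i a z = e.symm (affineMap a y) := by rw [← hez]; exact hloc y hyt hyb
  have hAv : LinearIndependent ℝ fun j => expEquiv a.2 (v j) :=
    hv.map' (expEquiv a.2).toLinearMap (expEquiv a.2).ker
  set v' : Fin k → EuclideanSpace ℝ (Fin d) := fun j =>
    mfderiv (𝓡 d) (𝓡 d) e.symm y (v j) with hv'
  have hL : (y, v) ∈ chartFrames e B ↔ FrameIn E z v' := by
    rw [frameIn_congr_fiber hB0, ← hez]
    exact ⟨fun h => h.2.2, fun h => ⟨hyt, hv, h⟩⟩
  have hR : (affineMap a y, fun j => expEquiv a.2 (v j)) ∈ chartFrames e B ↔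
      FrameIn E (D.g i a z) fun j => mfderiv (𝓡 d) (𝓡 d) (D.g i a).1 z (v' j) := by
    have hE : fiber E (D.g i a z) = fiber B (D.g i a z) := hB1
    have hw : (fun j => mfderiv (𝓡 d) (𝓡 d) (D.g i a).1 z (v' j) :
        Fin k → EuclideanSpace ℝ (Fin d)) =
        fun j => mfderiv (𝓡 d) (𝓡 d) e.symm (affineMap a y) (expEquiv a.2 (v j)) := by
      funext j
      rw [← hez]
      exact hder (v j)
    refine Iff.trans ⟨fun h => h.2.2, fun h => ⟨hay, hAv, h⟩⟩
      (Iff.trans (iff_of_eq (congrArg₂ (FrameIn B) hgz hw)).symm (frameIn_congr_fiber hE _).symm)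
  rw [hL, hR]
  let T := (f₀.1.mfderivToContinuousLinearEquiv (by simp : (∞ : ℕ∞ω) ≠ 0) x)
  -- Pull the frame back to `x`: membership at `f₀ x` and at the perturbed point are both equivalent
  -- to membership of `u` at `x`.
  let u : Fin k → EuclideanSpace ℝ (Fin d) := fun j => T.symm (v' j)
  have hu : (fun j => mfderiv (𝓡 d) (𝓡 d) f₀.1 x (u j) : Fin k → EuclideanSpace ℝ (Fin d)) = v' :=
    funext fun j => T.apply_symm_apply (v' j)
  have e0 := frameIn_iff_of_fiber_eq f₀.1 h0 u
  have e1 := frameIn_iff_of_fiber_eq ((D.g i a).comp f₀).1 h1 u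
  have hcomp : (fun j => mfderiv (𝓡 d) (𝓡 d) ((D.g i a).comp f₀).1 x (u j) :
      Fin k → EuclideanSpace ℝ (Fin d)) =
      fun j => mfderiv (𝓡 d) (𝓡 d) (D.g i a).1 z (v' j) := by
    funext j
    have h3 := mfderiv_comp_apply x ((D.g i a).1.mdifferentiable (by simp) (f₀ x))
      (f₀.1.mdifferentiable (by simp) x) (u j)
    exact h3.trans (congrArg (mfderiv (𝓡 d) (𝓡 d) (D.g i a).1 z) (congrFun hu j))
  rw [hu] at e0
  have e2 : FrameIn E x u ↔ FrameIn E (D.g i a z)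
      fun j => mfderiv (𝓡 d) (𝓡 d) (D.g i a).1 z (v' j) := by
    rw [← hcomp]
    exact e1
  exact e0.symm.trans e2

/-- The fibres of an invariant algebraic structure are trivial, for every stationary measure: at
almost every `f₀ x` the fibre is carried by almost every perturbation to the fibre at the end point,
so it is invariant under a neighbourhood of the identity in the special linear group. -/
theorem IsInvariantAlgebraicStructure.ae_trivial [CompactSpace M] [T2Space M] [BorelSpace M]
    {D : Perturbations G n} {f₀ : VolDiffeo G} {ε : ℝ} (hε : 0 < ε) (hεδ : ε < D.δ)
    {p₀ : ℝ≥0} {p : Fin n → ℝ≥0} (hp₀ : 0 < p₀) (hp : ∀ i, 0 < p i)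
    {ν : Measure M} [IsProbabilityMeasure ν] (hν : IsStationary (law D f₀ ε p₀ p) ν)
    {E : Set (GrBundle (d := d) k M)} (hE : IsInvariantAlgebraicStructure (law D f₀ ε p₀ p) ν E) :
    ∀ᵐ x ∂ν, fiber E x = ∅ ∨ fiber E x = univ := by
  obtain ⟨⟨B, hB, hEB⟩, halg, hinv⟩ := hE
  obtain ⟨hinv0, hinv1⟩ := ae_law_iff hεδ hp₀ hp hinv
  obtain ⟨hEB0, hEB1⟩ := ae_law_iff hεδ hp₀ hp (hν.ae_ae hEB)
  -- Algebraicity is needed at `f₀ x`, not at `x`; stationarity and the atom at `f₀` supply it.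
  obtain ⟨halg0, -⟩ := ae_law_iff hεδ hp₀ hp (hν.ae_ae halg)
  have hfin : IsFiniteMeasure ((volume : Measure (Param d)).restrict (closedCube d ε)) :=
    ⟨by simpa using (isCompact_closedCube d ε).measure_lt_top⟩
  have hcube : ∀ᵐ a ∂(volume : Measure (Param d)).restrict (closedCube d ε),
      a ∈ openCube d D.δ :=
    (ae_restrict_mem (isCompact_closedCube d ε).isClosed.measurableSet).mono
      fun a ha => closedCube_subset_openCube hεδ ha
  have key : ∀ i, ∀ᵐ x ∂ν, f₀ x ∈ (D.φ i).inner →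
      fiber E (f₀ x) = ∅ ∨ fiber E (f₀ x) = univ := by
    intro i
    set e := (D.φ i).chart with he
    set F := chartFrames e B with hF
    have hFm : MeasurableSet F := measurableSet_chartFrames (D.φ i).smooth hB
    have hA : MeasurableSet (f₀ ⁻¹' (D.φ i).inner) :=
      ((e.isOpen_inter_preimage Metric.isOpen_ball).preimage f₀.continuous).measurableSet
    -- A Borel coordinate map on all of `M`; the value 0 off the preimage of the chart neighbourhood
    -- is irrelevant, as `ν` is restricted to that preimage.
    obtain ⟨h, hh, hhA⟩ : ∃ h : M → EuclideanSpace ℝ (Fin d), Measurable h ∧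
        ∀ x ∈ f₀ ⁻¹' (D.φ i).inner, h x = e (f₀ x) := by
      classical
      refine ⟨(f₀ ⁻¹' (D.φ i).inner).piecewise (fun x => e (f₀ x)) fun _ => 0, ?_,
        fun x hx => piecewise_eq_of_mem _ _ _ hx⟩
      refine measurable_of_restrict_of_restrict_compl hA ?_ ?_
      · rw [domRestrict_piecewise]
        refine Continuous.measurable ?_
        exact (e.continuousOn.comp f₀.continuous.continuousOn fun x hx => hx.1).domRestrict
      · rw [domRestrict_piecewise_compl]
        exact measurable_const
    -- Triples (parameter, point, frame) violating the transport relation. It is stated with the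
    -- Borel set `B`, so `s` is Borel.
    let s : Set ((Param d × EuclideanSpace ℝ (Fin d)) ×
        (Fin k → EuclideanSpace ℝ (Fin d))) :=
      {q | LinearIndependent ℝ q.2 ∧ ¬ ((q.1.2, q.2) ∈ F ↔
        (affineMap q.1.1 q.1.2, fun j => expEquiv q.1.1.2 (q.2 j)) ∈ F)}
    have hs : MeasurableSet s := by
      have hm1 : Measurable fun q : (Param d × EuclideanSpace ℝ (Fin d)) ×
          (Fin k → EuclideanSpace ℝ (Fin d)) => (q.1.2, q.2) := by fun_prop
      have hm2 : Measurable fun q : (Param d × EuclideanSpace ℝ (Fin d)) ×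
          (Fin k → EuclideanSpace ℝ (Fin d)) =>
          (affineMap q.1.1 q.1.2, fun j => expEquiv q.1.1.2 (q.2 j)) := by
        refine Continuous.measurable (Continuous.prodMk ?_ (continuous_pi fun j => ?_))
        · exact continuous_affineMap.comp continuous_fst
        · exact continuous_expEquiv (by fun_prop) (by fun_prop)
      have hm3 : MeasurableSet {v : Fin k → EuclideanSpace ℝ (Fin d) | LinearIndependent ℝ v} :=
        isOpen_setOfPred_linearIndependent.measurableSet
      have h1 : MeasurableSet {q : (Param d × EuclideanSpace ℝ (Fin d)) ×
        (Fin k → EuclideanSpace ℝ (Fin d)) | (q.1.2, q.2) ∈ F} := hm1 hFm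
      have h2 : MeasurableSet {q : (Param d × EuclideanSpace ℝ (Fin d)) ×
        (Fin k → EuclideanSpace ℝ (Fin d)) |
          (affineMap q.1.1 q.1.2, fun j => expEquiv q.1.1.2 (q.2 j)) ∈ F} := hm2 hFm
      exact (measurable_snd hm3).inter (h1.iff h2).compl
    have hgood : ∀ᵐ a ∂(volume : Measure (Param d)).restrict (closedCube d ε),
        ∀ᵐ x ∂ν.restrict (f₀ ⁻¹' (D.φ i).inner), ∀ v, ((a, h x), v) ∉ s := by
      filter_upwards [hcube, hinv1 i, hEB1 i] with a ha h1 hB1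
      filter_upwards [ae_restrict_mem hA, ae_restrict_of_ae hinv0, ae_restrict_of_ae h1,
        ae_restrict_of_ae hEB0, ae_restrict_of_ae hB1] with x hx h2 h3 h4 h5 v hv
      refine hv.2 ?_
      simp only [hhA x hx]
      exact D.chartFrames_iff f₀ i ha hx h2 h3 h4 h5 hv.1
    have hswap := ae_ae_swap_of_forall_notMem hh hs hgood
    rw [ae_restrict_iff' hA] at hswap
    filter_upwards [hswap, halg0, hEB0] with x hx hax hBx hxA
    have hgx := hx hxA
    rw [hhA x hxA] at hgx
    have hd := mdifferentiable_of_mem_maximalAtlas (D.φ i).smooth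
    let L : TangentSpace (𝓡 d) (f₀ x) ≃ₗ[ℝ] EuclideanSpace ℝ (Fin d) :=
      (hd.mfderiv hxA.1).toLinearEquiv
    refine hax.eq_empty_or_univ_of_ae L hε (e (f₀ x)) (F := F) ?_ ?_
    · intro u hu
      have hLu : LinearIndependent ℝ fun j => L (u j) := hu.map' L.toLinearMap L.ker
      have hinvu : (fun j => mfderiv (𝓡 d) (𝓡 d) e.symm (e (f₀ x)) (L (u j)) :
          Fin k → EuclideanSpace ℝ (Fin d)) = u :=
        funext fun j => L.symm_apply_apply (u j)
      have hez : e.symm (e (f₀ x)) = f₀ x := e.left_inv hxA.1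
      have h1 : (e (f₀ x), fun j => L (u j)) ∈ F ↔ FrameIn B (f₀ x) u := by
        constructor
        · rintro ⟨-, -, h⟩
          rw [hez] at h
          exact hinvu ▸ h
        · intro h
          refine ⟨e.map_source hxA.1, hLu, ?_⟩
          rw [hez]
          exact hinvu.symm ▸ h
      refine Iff.trans ?_ ((frameIn_congr_fiber hBx u).trans h1.symm)
      exact ⟨fun h => ⟨hu, h⟩, fun h => h.2⟩
    · filter_upwards [hgx] with a ha v hv
      by_contra hc
      exact ha v ⟨hv, hc⟩
  -- The neighbourhoods cover `M`, so almost every fibre at `f₀ x` is trivial; the derivative of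
  -- `f₀` transfers this to `x`.
  filter_upwards [ae_all_iff.2 key, hinv0] with x hx h0
  obtain ⟨i, hi⟩ := D.cover (f₀ x)
  rcases hx i hi with h | h
  · left
    rw [h] at h0
    exact image_eq_empty.1 h0.symm
  · right
    rw [h] at h0
    refine eq_univ_of_forall fun W => ?_
    obtain ⟨W', hW', hWW⟩ := h0 ▸ mem_univ (grDeriv f₀.1 x W)
    rwa [← Gr.map_injective _ hWW]

end Main

end RandomWalk

end

theorem mainTheorem7 {d k n : ℕ} (hk : 1 ≤ k) (hkd : k < d)
    {M : Type*} [TopologicalSpace M] [ChartedSpace (EuclideanSpace ℝ (Fin d)) M]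
    [IsManifold (𝓡 d) ∞ M] [CompactSpace M] [T2Space M] [MeasurableSpace M] [BorelSpace M]
    (G : RandomWalk.Metric (d := d) M) (D : RandomWalk.Perturbations G n)
    (f₀ : RandomWalk.VolDiffeo G) (ε : ℝ) (hε : 0 < ε) (hε' : ε < 1 / 2) (hεδ : ε < D.δ)
    (p₀ : ℝ≥0) (p : Fin n → ℝ≥0) (hp₀ : 0 < p₀) (hp : ∀ i, 0 < p i)
    (hsum : p₀ + ∑ i, p i = 1)
    (ν : Measure M) [IsProbabilityMeasure ν]
    (hν : RandomWalk.IsStationary (RandomWalk.law D f₀ ε p₀ p) ν)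
    (ν₀ ν₁ : Measure M) (hdecomp : ν = ν₀ + ν₁) (hac : ν₀ ≪ RandomWalk.vol G) (hne : ν₀ ≠ 0) :
    ¬ ∃ E : Set (RandomWalk.GrBundle (d := d) k M),
      RandomWalk.IsInvariantAlgebraicStructure (RandomWalk.law D f₀ ε p₀ p) ν E ∧
      RandomWalk.IsProper ν E := by
  rintro ⟨E, hE, hproper⟩
  exact hproper (hE.ae_trivial hε hεδ hp₀ hp hν)
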